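/- Let $F, G \in \mathbb{C}[x,y,z,t,u,w]$ be two cubic forms that define a complete intersection threefold $X = X_{3,3} = V(F,G) \subset \mathbb{P}^5$ over $\mathbb{C}$ (that is, $F, G$ is a regular sequence). An ordinary triple point of $X$ is an isolated singular point $O$ of $X$ at which the tangent cone of $X$ is a cone over a smooth cubic surface. A triple point $O$ of $X$ is called inherited if there is a cubic fourfold containing $X$ (that is, a member $V(\alpha F + \beta G)$, $\alpha F+\beta G \neq 0$, of the pencil spanned by $F$ and $G$) that has multiplicity three at $O$. (1) If $X$ has only ordinary triple points as singularities and all of them are inherited, then $X$ has at most $9$ ordinary triple points. (2) The bound is attained: for all nonzero $a_1,a_2,a_3,a_4,b_1,b_2 \in \mathbb{C}$, with $b_3=-a_1$ and $b_4=-a_2$, the threefold defined by $$F = a_1z^3+a_2t^3+a_3u^3+a_4w^3,\qquad G = b_1x^3+b_2y^3+b_3z^3+b_4t^3$$ is a complete intersection whose only singularities are ordinary triple points, all of them inherited. There are exactly $9$ of them, and they form three collinear triples: there are three pairwise disjoint lines in $\mathbb{P}^5$ that together contain all of them, each line containing exactly three. -/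

import Mathlib

open MvPolynomial
open scoped LinearAlgebra.Projectivization

namespace TriplePoints

/-- Complex projective five-space. -/
abbrev P5 : Type := ℙ ℂ (Fin 6 → ℂ)

/-- The vector of partial derivatives of `f` at `v`. -/
noncomputable def gradient {n : ℕ} (f : MvPolynomial (Fin n) ℂ) (v : Fin n → ℂ) : Fin n → ℂ :=
  fun k => eval v (pderiv k f)

/-- `F` and `G` are cubic forms in six variables that form a regular sequence, i.e. they define a
complete intersection threefold `V(F, G)` of multidegree (3,3) in `P5`. -/
structure IsCompleteIntersection33 (F G : MvPolynomial (Fin 6) ℂ) : Prop where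
  homogeneous_left : F.IsHomogeneous 3
  homogeneous_right : G.IsHomogeneous 3
  regular : RingTheory.Sequence.IsRegular (MvPolynomial (Fin 6) ℂ) [F, G]

/-- The singular points of the scheme `V(F, G)` (of codimension two): the points of it at which the
Jacobian matrix of `(F, G)` has rank less than two. -/
def singularLocus (F G : MvPolynomial (Fin 6) ℂ) : Set P5 :=
  {P | eval P.rep F = 0 ∧ eval P.rep G = 0 ∧
    ¬ LinearIndependent ℂ ![gradient F P.rep, gradient G P.rep]}

/-- The point `P` is isolated in the set `S` for the Zariski topology: some form vanishes at all
other points of `S`, but not at `P`. -/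
def IsIsolatedIn (S : Set P5) (P : P5) : Prop :=
  P ∈ S ∧ ∃ (d : ℕ) (h : MvPolynomial (Fin 6) ℂ), h.IsHomogeneous d ∧ eval P.rep h ≠ 0 ∧
    ∀ Q ∈ S, Q ≠ P → eval Q.rep h = 0

/-- Passage to affine coordinates `y₀, …, y₄` centred at the point `[v]`, in the chart `x i = 1`
(used only if `v i ≠ 0`): `x i` becomes `1`, and each of the other five variables `x k` becomes
`y + v k / v i`, with `y` the affine coordinate that belongs to it. -/
noncomputable def localize (v : Fin 6 → ℂ) (i : Fin 6) :
    MvPolynomial (Fin 6) ℂ →ₐ[ℂ] MvPolynomial (Fin 5) ℂ :=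
  aeval (i.insertNth (α := fun _ => MvPolynomial (Fin 5) ℂ) 1
    (fun j => X j + C (v (i.succAbove j) / v i)))

/-- The ideal of the tangent cone at the origin of the affine scheme defined by `I`: it is
generated by the initial forms (nonzero homogeneous components of lowest degree) of the elements
of `I`. -/
noncomputable def tangentConeIdeal (I : Ideal (MvPolynomial (Fin 5) ℂ)) :
    Ideal (MvPolynomial (Fin 5) ℂ) :=
  Ideal.span {p | p ≠ 0 ∧ ∃ f ∈ I, ∃ n : ℕ,
    (∀ m < n, homogeneousComponent m f = 0) ∧ homogeneousComponent n f = p}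

/-- The cone in affine five-space defined by the ideal `J` is the cone over a smooth cubic surface
(a smooth cubic hypersurface `c = 0` of a hyperplane `l = 0` of projective four-space). -/
def IsConeOverSmoothCubicSurface (J : Ideal (MvPolynomial (Fin 5) ℂ)) : Prop :=
  ∃ l c : MvPolynomial (Fin 5) ℂ, l.IsHomogeneous 1 ∧ l ≠ 0 ∧ c.IsHomogeneous 3 ∧
    J = Ideal.span {l, c} ∧
    ∀ y : Fin 5 → ℂ, y ≠ 0 → eval y l = 0 → eval y c = 0 →
      LinearIndependent ℂ ![gradient l y, gradient c y]

/-- `P` is an ordinary triple point of `V(F, G)`: an isolated singular point at which the tangent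
cone is a cone over a smooth cubic surface. (The choice of the chart does not matter.) -/
def IsOrdinaryTriplePoint (F G : MvPolynomial (Fin 6) ℂ) (P : P5) : Prop :=
  IsIsolatedIn (singularLocus F G) P ∧
    ∃ i : Fin 6, P.rep i ≠ 0 ∧
      IsConeOverSmoothCubicSurface
        (tangentConeIdeal (Ideal.span {localize P.rep i F, localize P.rep i G}))

/-- `P` is a point of multiplicity three of the hypersurface `H = 0`: the local equation of the
hypersurface at `P` has order exactly three. (The choice of the chart does not matter.) -/
def IsTriplePointOfHypersurface (H : MvPolynomial (Fin 6) ℂ) (P : P5) : Prop :=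
  ∃ i : Fin 6, P.rep i ≠ 0 ∧ (∀ m < 3, homogeneousComponent m (localize P.rep i H) = 0) ∧
    homogeneousComponent 3 (localize P.rep i H) ≠ 0

/-- `P` is inherited: it is a triple point of some cubic fourfold `H = 0` that contains
`V(F, G)`. -/
def IsInherited (F G : MvPolynomial (Fin 6) ℂ) (P : P5) : Prop :=
  ∃ H : MvPolynomial (Fin 6) ℂ, H.IsHomogeneous 3 ∧ H ≠ 0 ∧ H ∈ Ideal.span {F, G} ∧
    IsTriplePointOfHypersurface H P

/-- `V(F, G)` is a complete intersection threefold of two cubics that has only ordinary triple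
points as singularities, all of them inherited. -/
structure HasOnlyInheritedTriplePoints (F G : MvPolynomial (Fin 6) ℂ) : Prop where
  completeIntersection : IsCompleteIntersection33 F G
  ordinary : ∀ P ∈ singularLocus F G, IsOrdinaryTriplePoint F G P
  inherited : ∀ P, IsOrdinaryTriplePoint F G P → IsInherited F G P

/-- The set of ordinary triple points of `V(F, G)`. -/
def triplePoints (F G : MvPolynomial (Fin 6) ℂ) : Set P5 :=
  {P | IsOrdinaryTriplePoint F G P}

/-- `T` consists of three collinear triples: there are three pairwise disjoint lines in `P5`
(two-dimensional subspaces of `ℂ⁶`) that together contain `T`, and each of them contains exactly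
three points of `T`. -/
def IsThreeCollinearTriples (T : Set P5) : Prop :=
  ∃ L : Fin 3 → Submodule ℂ (Fin 6 → ℂ),
    (∀ k, Module.finrank ℂ (L k) = 2) ∧
    (∀ j k, j ≠ k → Disjoint (L j) (L k)) ∧
    (∀ P ∈ T, ∃ k, P.submodule ≤ L k) ∧
    (∀ k, {P ∈ T | P.submodule ≤ L k}.encard = 3)

/-- The cubic form `a₁ z³ + a₂ t³ + a₃ u³ + a₄ w³` in the variables `x, y, z, t, u, w`. -/
noncomputable def exampleF (a₁ a₂ a₃ a₄ : ℂ) : MvPolynomial (Fin 6) ℂ :=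
  C a₁ * X 2 ^ 3 + C a₂ * X 3 ^ 3 + C a₃ * X 4 ^ 3 + C a₄ * X 5 ^ 3

/-- The cubic form `b₁ x³ + b₂ y³ + b₃ z³ + b₄ t³` in the variables `x, y, z, t, u, w`. -/
noncomputable def exampleG (b₁ b₂ b₃ b₄ : ℂ) : MvPolynomial (Fin 6) ℂ :=
  C b₁ * X 0 ^ 3 + C b₂ * X 1 ^ 3 + C b₃ * X 2 ^ 3 + C b₄ * X 3 ^ 3

end TriplePoints

namespace TriplePoints

/-! A cubic with a triple point is a cone with vertex there. So an inherited triple point `P` is a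
vertex of some member `h` of the pencil; if `k` is a second generator, the tangent cone of `X` at
`P` is cut out by `h` and the tangent hyperplane `k P P = 0`. With cubics replaced by their polar
trilinear forms, ordinariness becomes `IsOrdinaryVertex`
(`isConeOverSmoothCubicSurface_iff_isOrdinaryVertex`). The bound is then 9 = 3 · 3.

Each cone carries at most three of the points (`IsOrdinaryVertex.not_four`). The vertices of `h`
form a linear space; one of them on the tangent hyperplane at `P` and different from `P` would be a
singular point of the cubic surface. Hence the space is at most a projective line, on which `k` is a
nonzero binary cubic.

At most three members are such cones (`not_four_members`). Normalise three of them to `h₁ + h₂ + h₃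
= 0`, with vertices `P`, `Q`, `R`. Smoothness makes both the vertices and the tangent hyperplanes
`h₂ P P`, `h₃ Q Q`, `h₁ R R` linearly independent, and each hyperplane contains all three vertices.
A vertex `S` of a fourth member lies on the three hyperplanes, whose intersection in a
six-dimensional space is exactly the span of `P`, `Q`, `R`. Contracting the equation of `S` with
each vertex then gives `S = 0`.

For the example put `q₀ = b₁x³ + b₂y³`, `q₁ = a₁z³ + a₂t³`, `q₂ = -(a₃u³ + a₄w³)`. Then `F = q₁ -
q₂`, `G = q₀ - q₁` and `F + G = q₀ - q₂`. Each of these three members misses one pair of variables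
and is a cone whose vertices form the line of that pair; the corresponding `qₖ` cuts three points
out of this line. -/

/-- Trilinear forms on `V`. -/
abbrev TrilinearForm (V : Type*) [AddCommGroup V] [Module ℂ V] : Type _ :=
  V →ₗ[ℂ] V →ₗ[ℂ] V →ₗ[ℂ] ℂ

/-! ### Ordinary vertices of cones in a pencil, in terms of trilinear forms -/

section Vertex

variable {V : Type*} [AddCommGroup V] [Module ℂ V]

/-- Invariance of a trilinear form under permutations of its arguments. -/
structure IsSymmetric (T : TrilinearForm V) : Prop where
  swap_left : ∀ u v w, T u v w = T v u w
  swap_right : ∀ u v w, T u v w = T u w v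

theorem IsSymmetric.combination {S T : TrilinearForm V} (hS : IsSymmetric S) (hT : IsSymmetric T)
    (a b : ℂ) : IsSymmetric (a • S + b • T) where
  swap_left u v w := by simp [hS.swap_left u v w, hT.swap_left u v w]
  swap_right u v w := by simp [hS.swap_right u v w, hT.swap_right u v w]

/-- `P` is a vertex of the cubic cone `h`, and the cubic `k` cuts out of `h` an ordinary triple
point at `P`: the tangent hyperplane of `k` at `P` meets `h` in a cone over a smooth surface. -/
structure IsOrdinaryVertex (h k : TrilinearForm V) (P : V) : Prop where
  ne_zero : P ≠ 0
  vertex : h P = 0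
  mem : k P P P = 0
  tangent_ne_zero : k P P ≠ 0
  smooth : ∀ v, (∀ c : ℂ, v ≠ c • P) → k P P v = 0 → h v v v = 0 →
    LinearIndependent ℂ ![h v v, k P P]

variable {h k h₁ h₂ h₃ : TrilinearForm V} {P Q R : V}

/-- The condition depends only on the cone and on the pencil. -/
theorem IsOrdinaryVertex.change_basis (H : IsOrdinaryVertex h k P) {a b c : ℂ} (ha : a ≠ 0)
    (hc : c ≠ 0) : IsOrdinaryVertex (a • h) (b • h + c • k) P where
  ne_zero := H.ne_zero
  vertex := by simp [H.vertex]
  mem := by simp [H.vertex, H.mem]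
  tangent_ne_zero := by simp [H.vertex, H.tangent_ne_zero, hc]
  smooth v hv h0 h1 := by
    have := H.smooth v hv (by simpa [H.vertex, hc] using h0) (by simpa [ha] using h1)
    rw [LinearIndependent.pair_iff] at this ⊢
    intro s t hst
    have := this (s * a) (t * c) (by simpa [H.vertex, smul_smul] using hst)
    simpa [ha, hc] using this

/-- The gradient of `h` vanishes at a second vertex `v`, so on the tangent hyperplane `v` would
violate smoothness. -/
theorem IsOrdinaryVertex.tangent_apply_ne_zero (H : IsOrdinaryVertex h k P) {v : V}
    (hv : ∀ c : ℂ, v ≠ c • P) (h0 : h v = 0) : k P P v ≠ 0 := by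
  intro h1
  have := (H.smooth v hv h1 (by simp [h0])).ne_zero 0
  simp [h0] at this

/-- A cone contains at most three ordinary vertices. -/
theorem IsOrdinaryVertex.not_four {P₁ P₂ P₃ : V} (hk : IsSymmetric k) (H : IsOrdinaryVertex h k P)
    (h1 : h P₁ = 0) (h2 : h P₂ = 0) (h3 : h P₃ = 0)
    (k1 : k P₁ P₁ P₁ = 0) (k2 : k P₂ P₂ P₂ = 0) (k3 : k P₃ P₃ P₃ = 0)
    (n1 : ∀ c : ℂ, P₁ ≠ c • P) (n2 : ∀ c : ℂ, P₂ ≠ c • P) (n3 : ∀ c : ℂ, P₃ ≠ c • P)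
    (n12 : ∀ c : ℂ, P₂ ≠ c • P₁) (n13 : ∀ c : ℂ, P₃ ≠ c • P₁) (n23 : ∀ c : ℂ, P₃ ≠ c • P₂) :
    False := by
  have d1 := H.tangent_apply_ne_zero n1 h1
  have key : ∀ v, h v = 0 → k v v v = 0 → (∀ c : ℂ, v ≠ c • P) → (∀ c : ℂ, v ≠ c • P₁) →
      ∃ c : ℂ, c ≠ 0 ∧ v = c • (k P P P₁ • P₁ - k P₁ P₁ P • P) := by
    intro v hv kv nv nv1
    have dv := H.tangent_apply_ne_zero nv hv
    -- This combination is a vertex of `h` on the tangent hyperplane at `P`, hence a multiple of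
    -- `P`: all vertices lie on the line through `P` and `P₁`.
    obtain ⟨s, hs⟩ : ∃ s : ℂ, k P P P₁ • v - k P P v • P₁ = s • P := by
      by_contra! hcon
      refine H.tangent_apply_ne_zero hcon (by simp [h1, hv]) ?_
      simp [mul_comm]
    set c := k P P v / k P P P₁ with hc
    have hc0 : c ≠ 0 := div_ne_zero dv d1
    have hv' : v = c • P₁ + (s / k P P P₁) • P := by
      have : k P P P₁ • v = k P P v • P₁ + s • P := by rw [← hs]; abel
      have h' : v = (k P P P₁)⁻¹ • (k P P P₁ • v) := by rw [smul_smul, inv_mul_cancel₀ d1, one_smul]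
      rw [h', this, smul_add, smul_smul, smul_smul, hc]
      congr 2 <;> ring
    set r := s / k P P P₁
    have hr0 : r ≠ 0 := fun h0 => nv1 c (by rw [hv', h0]; simp)
    -- A third of the value of `k` at `c • P₁ + r • P`. The roots `P` and `P₁` account for the
    -- factor `c * r`, so the linear factor determines the remaining point.
    have : c * r * (c * k P₁ P₁ P + r * k P P P₁) = 0 := by
      have e1 : k P P₁ P = k P P P₁ := hk.swap_right _ _ _
      have e2 : k P₁ P P = k P P P₁ := by rw [hk.swap_left, e1]
      have e3 : k P₁ P P₁ = k P₁ P₁ P := hk.swap_right _ _ _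
      have e4 : k P P₁ P₁ = k P₁ P₁ P := by rw [hk.swap_left, e3]
      rw [hv'] at kv
      simp only [map_add, map_smul, LinearMap.add_apply, LinearMap.smul_apply, smul_eq_mul, k1,
        H.mem, e1, e2, e3, e4] at kv
      linear_combination kv / 3
    have : c * k P₁ P₁ P + r * k P P P₁ = 0 := by simpa [hc0, hr0] using this
    refine ⟨c / k P P P₁, div_ne_zero hc0 d1, ?_⟩
    rw [hv', smul_sub, smul_smul, smul_smul, sub_eq_add_neg, ← neg_smul,
      div_mul_cancel₀ _ d1]
    congr 2
    field_simp
    linear_combination this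
  obtain ⟨c2, hc2, e2⟩ := key _ h2 k2 n2 n12
  obtain ⟨c3, hc3, e3⟩ := key _ h3 k3 n3 n13
  refine n23 (c3 / c2) ?_
  rw [e2, smul_smul, div_mul_cancel₀ _ hc2, e3]

/-- Three cones of a pencil, normalised to have sum zero, with an ordinary vertex on each. -/
structure IsVertexTriple (h₁ h₂ h₃ : TrilinearForm V) (P Q R : V) : Prop where
  symm₁ : IsSymmetric h₁
  symm₂ : IsSymmetric h₂
  symm₃ : IsSymmetric h₃
  sum_eq_zero : ∀ u v w, h₁ u v w + h₂ u v w + h₃ u v w = 0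
  vertex₁ : IsOrdinaryVertex h₁ h₂ P
  vertex₂ : IsOrdinaryVertex h₂ h₃ Q
  vertex₃ : IsOrdinaryVertex h₃ h₁ R

theorem IsVertexTriple.rotate (H : IsVertexTriple h₁ h₂ h₃ P Q R) :
    IsVertexTriple h₂ h₃ h₁ Q R P where
  symm₁ := H.symm₂
  symm₂ := H.symm₃
  symm₃ := H.symm₁
  sum_eq_zero u v w := by rw [← H.sum_eq_zero u v w]; ring
  vertex₁ := H.vertex₂
  vertex₂ := H.vertex₃
  vertex₃ := H.vertex₁

namespace IsVertexTriple

theorem apply_eq_zero (H : IsVertexTriple h₁ h₂ h₃ P Q R) (u w : V) :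
    h₁ P u w = 0 ∧ h₁ u P w = 0 ∧ h₁ u w P = 0 := by
  have : h₁ P u w = 0 := by simp [H.vertex₁.vertex]
  refine ⟨this, by rw [H.symm₁.swap_left, this], ?_⟩
  rw [H.symm₁.swap_right, H.symm₁.swap_left, this]

/-- `h₁ = -(h₂ + h₃)`, where `Q` kills `h₂` and `R` kills `h₃`. -/
theorem cross (H : IsVertexTriple h₁ h₂ h₃ P Q R) (w : V) : h₁ Q R w = 0 ∧ h₁ R Q w = 0 := by
  have : h₁ Q R w = 0 := by
    linear_combination H.sum_eq_zero Q R w - (H.rotate.apply_eq_zero R w).1 -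
      (H.rotate.rotate.apply_eq_zero Q w).2.1
  exact ⟨this, by rw [H.symm₁.swap_left, this]⟩

theorem ne_smul (H : IsVertexTriple h₁ h₂ h₃ P Q R) (c : ℂ) : P ≠ c • Q := by
  intro h
  apply H.vertex₁.tangent_ne_zero
  rw [h]
  simp [H.vertex₂.vertex]

theorem ne_smul' (H : IsVertexTriple h₁ h₂ h₃ P Q R) (c : ℂ) : Q ≠ c • P := by
  intro h
  have hc : c ≠ 0 := by
    rintro rfl
    exact H.vertex₂.ne_zero (by simpa using h)
  exact H.ne_smul c⁻¹ (by rw [h, smul_smul, inv_mul_cancel₀ hc, one_smul])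

theorem tangent_apply (H : IsVertexTriple h₁ h₂ h₃ P Q R) :
    h₂ P P P = 0 ∧ h₂ P P Q = 0 ∧ h₂ P P R = 0 := by
  refine ⟨H.vertex₁.mem, (H.rotate.apply_eq_zero P P).2.2, ?_⟩
  linear_combination H.sum_eq_zero P P R - (H.apply_eq_zero P R).1 -
      (H.rotate.rotate.apply_eq_zero P P).2.2

/-- If `P` lay on the line through `Q` and `R`, then `h₂ P P` would be proportional to `h₂ R R = -h₁
R R`, since `Q` is a vertex of `h₂`. This contradicts smoothness at `P`, tested on the vector `R`.
Applied cyclically, it gives the independence of the three vertices. -/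
theorem eq_zero_of_combination (H : IsVertexTriple h₁ h₂ h₃ P Q R) {s t p : ℂ}
    (h : s • Q + t • R = p • P) : s = 0 ∧ t = 0 := by
  by_cases ht : t = 0
  · refine ⟨?_, ht⟩
    by_contra hs
    refine H.ne_smul' (s⁻¹ * p) ?_
    rw [← smul_smul, ← h, ht, zero_smul, add_zero, smul_smul, inv_mul_cancel₀ hs, one_smul]
  exfalso
  have hp : p ≠ 0 := by
    rintro rfl
    refine H.rotate.ne_smul' (-(t⁻¹ * s)) ?_
    have : t • R = -(s • Q) := by rw [zero_smul] at h; exact eq_neg_of_add_eq_zero_right h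
    rw [neg_smul, ← smul_smul, ← smul_neg, ← this, smul_smul, inv_mul_cancel₀ ht, one_smul]
  have key : ∀ w, p ^ 2 * h₂ P P w = - t ^ 2 * h₁ R R w := by
    intro w
    have e1 : h₂ (p • P) (p • P) w = p ^ 2 * h₂ P P w := by simp; ring
    have e2 : h₂ (s • Q + t • R) (s • Q + t • R) w = t ^ 2 * h₂ R R w := by
      simp [(H.rotate.apply_eq_zero _ _).1, (H.rotate.apply_eq_zero _ _).2.1]; ring
    have e3 : h₂ R R w = - h₁ R R w := by
      linear_combination H.sum_eq_zero R R w - (H.rotate.rotate.apply_eq_zero R w).1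
    rw [← e1, ← h, e2, e3]; ring
  have := H.vertex₁.smooth R (H.rotate.rotate.ne_smul) H.tangent_apply.2.2 H.vertex₃.mem
  rw [LinearIndependent.pair_iff] at this
  have := this (t ^ 2) (p ^ 2) (by ext w; simp [key w])
  simp [ht] at this

/-- By `cross`, the gradient of `h₁` at a combination of `Q` and `R` has no mixed term. A relation
among the hyperplanes thus yields a point of the tangent cone at `P` where this gradient is a
multiple of `h₂ P P`. -/
theorem linearIndependent (H : IsVertexTriple h₁ h₂ h₃ P Q R) (a b c : ℂ)
    (h : a • h₂ P P + b • h₃ Q Q + c • h₁ R R = 0) : a = 0 ∧ b = 0 ∧ c = 0 := by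
  -- The sign comes from `h₁ Q Q = -h₃ Q Q`.
  obtain ⟨s, hs⟩ := IsAlgClosed.exists_pow_nat_eq (-b) (n := 2) (by norm_num)
  obtain ⟨t, ht⟩ := IsAlgClosed.exists_pow_nat_eq c (n := 2) (by norm_num)
  have key : ∀ w, h₁ (s • Q + t • R) (s • Q + t • R) w = b * h₃ Q Q w + c * h₁ R R w := by
    intro w
    have e3 : h₁ Q Q w = - h₃ Q Q w := by
      linear_combination H.sum_eq_zero Q Q w - (H.rotate.apply_eq_zero Q w).1
    simp only [map_add, map_smul, LinearMap.add_apply, LinearMap.smul_apply, smul_eq_mul,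
      (H.cross w).1, (H.cross w).2, e3]
    linear_combination - h₃ Q Q w * hs + h₁ R R w * ht
  have hw : ∀ w, a * h₂ P P w + (b * h₃ Q Q w + c * h₁ R R w) = 0 := fun w => by
    rw [← add_assoc]
    simpa using LinearMap.congr_fun h w
  by_cases hv : ∃ p : ℂ, s • Q + t • R = p • P
  · obtain ⟨p, hp⟩ := hv
    obtain ⟨rfl, rfl⟩ := H.eq_zero_of_combination hp
    have hb : b = 0 := by simpa using hs.symm
    have hc : c = 0 := by simpa using ht.symm
    refine ⟨?_, hb, hc⟩
    by_contra ha
    apply H.vertex₁.tangent_ne_zero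
    ext w
    simpa [hb, hc, ha] using hw w
  push Not at hv
  exfalso
  have h3 : h₁ (s • Q + t • R) (s • Q + t • R) (s • Q + t • R) = 0 := by
    rw [key]
    have f1 : h₃ Q Q Q = 0 := H.rotate.tangent_apply.1
    have f2 : h₃ Q Q R = 0 := H.rotate.tangent_apply.2.1
    have f3 : h₁ R R Q = 0 := H.rotate.rotate.tangent_apply.2.2
    have f4 : h₁ R R R = 0 := H.rotate.rotate.tangent_apply.1
    simp [f1, f2, f3, f4]
  have := H.vertex₁.smooth _ hv (by simp [H.tangent_apply.2.1, H.tangent_apply.2.2]) h3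
  rw [LinearIndependent.pair_iff] at this
  have := this 1 a (by
    ext w
    simp only [LinearMap.add_apply, LinearMap.smul_apply, smul_eq_mul, LinearMap.zero_apply, key]
    linear_combination hw w)
  simp at this

/-- In a six-dimensional space a fourth cone of the pencil has no vertex. -/
theorem no_fourth [FiniteDimensional ℂ V] (hV : Module.finrank ℂ V = 6)
    (H : IsVertexTriple h₁ h₂ h₃ P Q R) {α β : ℂ}
    (hα : α ≠ 0) (hβ : β ≠ 0) (hαβ : α ≠ β) {S : V} (hS : α • h₁ S + β • h₂ S = 0) : S = 0 := by
  have hS' : ∀ u w, α * h₁ S u w + β * h₂ S u w = 0 := fun u w => by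
    simpa using LinearMap.congr_fun₂ hS u w
  have r1 : ∀ u w, h₁ u P w = 0 := fun u w => (H.apply_eq_zero u w).2.1
  have r2 : ∀ u w, h₂ u Q w = 0 := fun u w => (H.rotate.apply_eq_zero u w).2.1
  have r3 : ∀ u w, h₃ u R w = 0 := fun u w => (H.rotate.rotate.apply_eq_zero u w).2.1
  have cyc : ∀ {T : TrilinearForm V}, IsSymmetric T → ∀ u v, T u v v = T v v u := fun hT u v => by
    rw [hT.swap_left, hT.swap_right]
  have lP : h₂ P P S = 0 := by
    have := hS' P P
    rw [r1, mul_zero, zero_add] at this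
    rw [← cyc H.symm₂]
    simpa [hβ] using this
  have lQ : h₃ Q Q S = 0 := by
    have := hS' Q Q
    rw [r2, mul_zero, add_zero] at this
    rw [← cyc H.symm₃]
    have h1 : h₁ S Q Q = 0 := by simpa [hα] using this
    linear_combination H.sum_eq_zero S Q Q - h1 - r2 S Q
  have lR : h₁ R R S = 0 := by
    have := hS' R R
    rw [← cyc H.symm₁]
    -- As `R` kills `h₃`, here `h₂ S R R = -h₁ S R R`.
    have h1 : (α - β) * h₁ S R R = 0 := by
      linear_combination this - β * H.sum_eq_zero S R R + β * r3 S R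
    simpa [sub_ne_zero.2 hαβ] using h1
  have indep : LinearIndependent ℂ ![h₂ P P, h₃ Q Q, h₁ R R] := by
    rw [Fintype.linearIndependent_iff]
    intro g hg
    have := H.linearIndependent (g 0) (g 1) (g 2) (by simpa [Fin.sum_univ_three] using hg)
    intro i
    fin_cases i <;> simp [this]
  have indepP : LinearIndependent ℂ ![P, Q, R] := by
    rw [Fintype.linearIndependent_iff]
    intro g hg
    have hg' : g 0 • P + g 1 • Q + g 2 • R = 0 := by simpa [Fin.sum_univ_three] using hg
    have h12 := H.eq_zero_of_combination (s := g 1) (t := g 2) (p := -g 0) (by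
      rw [neg_smul, eq_neg_iff_add_eq_zero, ← hg']; abel)
    have h0 := H.rotate.eq_zero_of_combination (s := g 2) (t := g 0) (p := -g 1) (by
      rw [neg_smul, eq_neg_iff_add_eq_zero, ← hg']; abel)
    intro i
    fin_cases i <;> simp [h12, h0]
  let K : Submodule ℂ V := (Submodule.span ℂ (Set.range ![h₂ P P, h₃ Q Q, h₁ R R])).dualCoannihilator
  -- Dimension six enters here: `K` has dimension 6 - 3, the same as the span of the three vertices.
  have hK : Module.finrank ℂ K = 3 := by
    have h1 := Subspace.finrank_add_finrank_dualCoannihilator_eq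
      (Submodule.span ℂ (Set.range ![h₂ P P, h₃ Q Q, h₁ R R]))
    rw [finrank_span_eq_card indep, hV] at h1
    simp only [Fintype.card_fin] at h1
    change _ + Module.finrank ℂ K = 6 at h1
    omega
  have memK : ∀ v, v ∈ K ↔ h₂ P P v = 0 ∧ h₃ Q Q v = 0 ∧ h₁ R R v = 0 := by
    intro v
    rw [Submodule.mem_dualCoannihilator]
    constructor
    · intro hv
      exact ⟨hv _ (Submodule.subset_span ⟨0, rfl⟩), hv _ (Submodule.subset_span ⟨1, rfl⟩),
        hv _ (Submodule.subset_span ⟨2, rfl⟩)⟩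
    · rintro ⟨a, b, c⟩ φ hφ
      induction hφ using Submodule.span_induction with
      | mem x hx => obtain ⟨i, rfl⟩ := hx; fin_cases i <;> simpa
      | zero => simp
      | add x y _ _ hx hy => simp [hx, hy]
      | smul a x _ hx => simp [hx]
  have hle : Submodule.span ℂ (Set.range ![P, Q, R]) ≤ K := by
    rw [Submodule.span_le]
    have t1 := H.tangent_apply
    have t2 := H.rotate.tangent_apply
    have t3 := H.rotate.rotate.tangent_apply
    rintro _ ⟨i, rfl⟩
    rw [SetLike.mem_coe, memK]
    fin_cases i <;> simp [t1, t2, t3]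
  have hEq := Submodule.eq_of_le_of_finrank_eq hle (by
    rw [finrank_span_eq_card indepP, hK, Fintype.card_fin])
  have hSK : S ∈ K := (memK S).2 ⟨lP, lQ, lR⟩
  rw [← hEq, Submodule.mem_span_range_iff_exists_fun] at hSK
  obtain ⟨c, hc⟩ := hSK
  have hc : S = c 0 • P + c 1 • Q + c 2 • R := by rw [← hc]; simp [Fin.sum_univ_three]
  have x1 : ∀ w, h₁ Q R w = 0 ∧ h₁ R Q w = 0 := H.cross
  have x2 : ∀ w, h₂ R P w = 0 ∧ h₂ P R w = 0 := H.rotate.cross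
  have x3 : ∀ w, h₃ P Q w = 0 ∧ h₃ Q P w = 0 := H.rotate.rotate.cross
  have s1 : ∀ u w, h₁ P u w = 0 := fun u w => (H.apply_eq_zero u w).1
  have s2 : ∀ u w, h₂ Q u w = 0 := fun u w => (H.rotate.apply_eq_zero u w).1
  -- Contracting the equation of `S` with `P` leaves only `β * c 0 * h₂ P P`; the other terms vanish
  -- by the vertex property or by `cross`.
  have c0 : c 0 = 0 := by
    by_contra h0
    apply H.vertex₁.tangent_ne_zero
    ext w
    have := hS' P w
    simpa [hc, r1, s2, x2, hβ, h0] using this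
  have c1 : c 1 = 0 := by
    by_contra h0
    apply H.vertex₂.tangent_ne_zero
    ext w
    have h1 := hS' Q w
    have h2 := H.sum_eq_zero Q Q w
    have : h₁ Q Q w = 0 := by simpa [hc, r2, s1, x1, hα, h0] using h1
    simpa [this, s2] using h2
  have c2 : c 2 = 0 := by
    by_contra h0
    apply H.vertex₃.tangent_ne_zero
    ext w
    have h1 := hS' R w
    have h2 := H.sum_eq_zero R R w
    rw [r3, add_zero] at h2
    have : c 2 * ((α - β) * h₁ R R w) = 0 := by
      simp [hc, s1, s2, x1, x2] at h1
      linear_combination h1 - β * c 2 * h2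
    simpa [sub_ne_zero.2 hαβ, h0] using this
  rw [hc, c0, c1, c2]
  simp

end IsVertexTriple

end Vertex

/-! ### Orders, initial forms and tangent cones -/

section InitialForms

variable {n : ℕ}

/-- The polynomials of order at least `k` at the origin. -/
def orderIdeal (n k : ℕ) : Ideal (MvPolynomial (Fin n) ℂ) where
  carrier := {f | ∀ d : Fin n →₀ ℕ, d.degree < k → coeff d f = 0}
  zero_mem' := by simp
  add_mem' hf hg d hd := by simp [hf d hd, hg d hd]
  smul_mem' r f hf d hd := by
    rw [smul_eq_mul, coeff_mul]
    refine Finset.sum_eq_zero fun x hx => ?_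
    rw [Finset.HasAntidiagonal.mem_antidiagonal] at hx
    have : x.1.degree + x.2.degree = d.degree := by rw [← hx, map_add]
    rw [hf x.2 (by omega), mul_zero]

theorem mem_orderIdeal {k : ℕ} {f : MvPolynomial (Fin n) ℂ} :
    f ∈ orderIdeal n k ↔ ∀ d : Fin n →₀ ℕ, d.degree < k → coeff d f = 0 := Iff.rfl

theorem mem_orderIdeal_iff {k : ℕ} {f : MvPolynomial (Fin n) ℂ} :
    f ∈ orderIdeal n k ↔ ∀ m < k, homogeneousComponent m f = 0 := by
  rw [mem_orderIdeal]
  constructor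
  · intro h m hm
    ext d
    rw [coeff_homogeneousComponent, coeff_zero]
    split_ifs with hd
    · exact h d (by omega)
    · rfl
  · intro h d hd
    have := congrArg (coeff d) (h _ hd)
    rwa [coeff_homogeneousComponent, if_pos rfl, coeff_zero] at this

theorem orderIdeal_zero (f : MvPolynomial (Fin n) ℂ) : f ∈ orderIdeal n 0 := by
  simp [mem_orderIdeal]

theorem orderIdeal_succ {k : ℕ} {f : MvPolynomial (Fin n) ℂ} :
    f ∈ orderIdeal n (k + 1) ↔ f ∈ orderIdeal n k ∧ homogeneousComponent k f = 0 := by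
  simp only [mem_orderIdeal_iff, Nat.lt_succ_iff_lt_or_eq]
  constructor
  · intro h
    exact ⟨fun m hm => h m (Or.inl hm), h k (Or.inr rfl)⟩
  · rintro ⟨h1, h2⟩ m (hm | rfl)
    exacts [h1 m hm, h2]

theorem _root_.MvPolynomial.IsHomogeneous.mem_orderIdeal {f : MvPolynomial (Fin n) ℂ} {k m : ℕ}
    (hf : f.IsHomogeneous m) (hk : k ≤ m) : f ∈ orderIdeal n k := fun d hd =>
  hf.coeff_eq_zero (by omega)

theorem orderIdeal_anti {k m : ℕ} (h : k ≤ m) : orderIdeal n m ≤ orderIdeal n k :=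
  fun _ hf d hd => hf d (by omega)

theorem mul_mem_orderIdeal {a b : ℕ} {f g : MvPolynomial (Fin n) ℂ} (hf : f ∈ orderIdeal n a)
    (hg : g ∈ orderIdeal n b) : f * g ∈ orderIdeal n (a + b) := by
  intro d hd
  rw [coeff_mul]
  refine Finset.sum_eq_zero fun x hx => ?_
  rw [Finset.HasAntidiagonal.mem_antidiagonal] at hx
  have : x.1.degree + x.2.degree = d.degree := by rw [← hx, map_add]
  by_cases h : x.1.degree < a
  · rw [hf _ h, zero_mul]
  · rw [hg x.2 (by omega), mul_zero]

/-- The leading form of a product. -/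
theorem homogeneousComponent_mul_of_order {a b : ℕ} {f g : MvPolynomial (Fin n) ℂ}
    (hf : f ∈ orderIdeal n a) (hg : g ∈ orderIdeal n b) :
    homogeneousComponent (a + b) (f * g) =
      homogeneousComponent a f * homogeneousComponent b g := by
  ext d
  rw [coeff_homogeneousComponent]
  split_ifs with hd
  · rw [coeff_mul, coeff_mul]
    refine Finset.sum_congr rfl fun x hx => ?_
    rw [Finset.HasAntidiagonal.mem_antidiagonal] at hx
    have : x.1.degree + x.2.degree = d.degree := by rw [← hx, map_add]
    rw [coeff_homogeneousComponent, coeff_homogeneousComponent]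
    rcases lt_trichotomy x.1.degree a with h | h | h
    · simp [hf _ h]
    · rw [if_pos h, if_pos (by omega)]
    · simp [hg x.2 (by omega)]
  · exact (((homogeneousComponent_isHomogeneous a f).mul
      (homogeneousComponent_isHomogeneous b g)).coeff_eq_zero hd).symm

theorem homogeneousComponent_mul_isHomogeneous {a b : ℕ} (f : MvPolynomial (Fin n) ℂ)
    {g : MvPolynomial (Fin n) ℂ} (hg : g.IsHomogeneous b) :
    homogeneousComponent (a + b) (f * g) = homogeneousComponent a f * g := by
  ext d
  rw [coeff_homogeneousComponent]
  split_ifs with hd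
  · rw [coeff_mul, coeff_mul]
    refine Finset.sum_congr rfl fun x hx => ?_
    rw [Finset.HasAntidiagonal.mem_antidiagonal] at hx
    have : x.1.degree + x.2.degree = d.degree := by rw [← hx, map_add]
    rw [coeff_homogeneousComponent]
    split_ifs with h
    · rfl
    · rw [hg.coeff_eq_zero (d := x.2) (by omega), mul_zero, mul_zero]
  · exact (((homogeneousComponent_isHomogeneous a f).mul hg).coeff_eq_zero hd).symm

theorem homogeneousComponent_mul_of_lt {a b : ℕ} (f : MvPolynomial (Fin n) ℂ)
    {g : MvPolynomial (Fin n) ℂ} (hg : g.IsHomogeneous b) (h : a < b) :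
    homogeneousComponent a (f * g) = 0 :=
  mem_orderIdeal_iff.1 (Ideal.mul_mem_left _ f (hg.mem_orderIdeal le_rfl)) a h

theorem _root_.MvPolynomial.IsHomogeneous.component_self {f : MvPolynomial (Fin n) ℂ} {m : ℕ}
    (hf : f.IsHomogeneous m) : homogeneousComponent m f = f := homogeneousComponent_eq_self hf

theorem isRelPrime_linear {l a c : MvPolynomial (Fin n) ℂ} (hl : l.IsHomogeneous 1) (hl0 : l ≠ 0)
    (hlc : ¬ l ∣ c) (h : l ∣ a * c) : l ∣ a := by
  have hirr : Irreducible l := by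
    refine irreducible_of_totalDegree_eq_one (hl.totalDegree hl0) fun x hx => ?_
    obtain ⟨d, hd⟩ := ne_zero_iff.1 hl0
    rw [isUnit_iff_ne_zero]
    rintro rfl
    exact hd (zero_dvd_iff.1 (hx d))
  exact (hirr.prime.dvd_or_dvd h).resolve_right hlc

variable {c g a b f : MvPolynomial (Fin n) ℂ} {m : ℕ}

/-- The component of degree `m` of `a * c + b * g`, if `c` is a cubic form and `g` has order one. -/
theorem component_combination (hc : c.IsHomogeneous 3) (hg : g ∈ orderIdeal n 1)
    (hb : b ∈ orderIdeal n (m - 1)) :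
    homogeneousComponent m (a * c + b * g) =
      (if 3 ≤ m then homogeneousComponent (m - 3) a * c else 0) +
      (if 1 ≤ m then homogeneousComponent (m - 1) b * homogeneousComponent 1 g else 0) := by
  rw [map_add]
  congr 1
  · split_ifs with h
    · conv_lhs => rw [← Nat.sub_add_cancel h]
      exact homogeneousComponent_mul_isHomogeneous a hc
    · exact homogeneousComponent_mul_of_lt a hc (by omega)
  · split_ifs with h
    · conv_lhs => rw [← Nat.sub_add_cancel h]
      exact homogeneousComponent_mul_of_order hb hg
    · obtain rfl : m = 0 := by omega
      exact mem_orderIdeal_iff.1 (Ideal.mul_mem_left _ b hg) 0 (by omega)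

/-- Below degree three `a * c` contributes nothing, and the leading form of `b * g` is a product in
a domain. Because of truncated subtraction the cases `m = 0` and `m = 1` are empty. -/
theorem order_of_combination_le_three (hc : c.IsHomogeneous 3) (hg : g ∈ orderIdeal n 1)
    (hl0 : homogeneousComponent 1 g ≠ 0) (hm : m ≤ 3) (hf : a * c + b * g ∈ orderIdeal n m) :
    b ∈ orderIdeal n (m - 1) := by
  induction m with
  | zero => exact orderIdeal_zero b
  | succ m ih =>
    have hb := ih (by omega) (orderIdeal_anti (Nat.le_succ m) hf)
    rcases Nat.eq_zero_or_pos m with rfl | hpos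
    · exact orderIdeal_zero b
    have h0 := (orderIdeal_succ.1 hf).2
    rw [component_combination hc hg hb, if_neg (by omega), if_pos (by omega), zero_add] at h0
    have : homogeneousComponent (m - 1) b = 0 := by simpa [hl0] using h0
    have := orderIdeal_succ.2 ⟨hb, this⟩
    rwa [Nat.sub_add_cancel hpos] at this

/-- A combination of order `m` of a cubic form `c` and of `g`, whose linear part does not divide
`c`, is also a combination in which no cancellation occurs. -/
theorem exists_combination_of_order (hc : c.IsHomogeneous 3) (hg : g ∈ orderIdeal n 1)
    (hl0 : homogeneousComponent 1 g ≠ 0) (hlc : ¬ homogeneousComponent 1 g ∣ c)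
    (hf : f ∈ Ideal.span {c, g}) (hm : f ∈ orderIdeal n m) :
    ∃ a b, f = a * c + b * g ∧ a ∈ orderIdeal n (m - 3) ∧ b ∈ orderIdeal n (m - 1) := by
  set l := homogeneousComponent 1 g with hl
  have hlh : l.IsHomogeneous 1 := homogeneousComponent_isHomogeneous 1 g
  induction m with
  | zero =>
    obtain ⟨a, b, h⟩ := Ideal.mem_span_pair.1 hf
    exact ⟨a, b, h.symm, orderIdeal_zero a, orderIdeal_zero b⟩
  | succ m ih =>
    obtain ⟨a, b, h, ha, hb⟩ := ih (orderIdeal_anti (Nat.le_succ m) hm)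
    by_cases hm3 : m < 3
    · refine ⟨a, b, h, ?_, ?_⟩
      · rw [Nat.sub_eq_zero_of_le (by omega)]
        exact orderIdeal_zero a
      · exact order_of_combination_le_three hc hg hl0 (by omega) (h ▸ hm)
    have h0 := (orderIdeal_succ.1 hm).2
    rw [h, component_combination hc hg hb, if_pos (by omega), if_pos (by omega)] at h0
    -- The leading terms cancel, and the prime `l` does not divide `c`.
    have hdvd : l ∣ homogeneousComponent (m - 3) a := by
      refine isRelPrime_linear hlh hl0 hlc ⟨-homogeneousComponent (m - 1) b, ?_⟩
      linear_combination h0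
    have hself := (homogeneousComponent_isHomogeneous (m - 3) a).component_self
    obtain ⟨e, he, hem⟩ : ∃ e, homogeneousComponent (m - 3) a = e * l ∧
        (e = 0 ∨ 4 ≤ m ∧ e.IsHomogeneous (m - 4)) := by
      obtain ⟨e, he⟩ := hdvd
      by_cases hm4 : 4 ≤ m
      · refine ⟨homogeneousComponent (m - 4) e, ?_,
          Or.inr ⟨hm4, homogeneousComponent_isHomogeneous _ _⟩⟩
        rw [← homogeneousComponent_mul_isHomogeneous e hlh, mul_comm e, ← he,
          show m - 4 + 1 = m - 3 by omega, hself]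
      -- Here `m = 3`: a constant divisible by `l` is zero.
      · refine ⟨0, ?_, Or.inl rfl⟩
        rw [← hself, he, zero_mul, mul_comm]
        exact homogeneousComponent_mul_of_lt e hlh (by omega)
    have hb' : homogeneousComponent (m - 1) b = - (e * c) := by
      refine mul_right_cancel₀ hl0 ?_
      rw [he] at h0
      linear_combination h0
    have heg : e * g ∈ orderIdeal n (m - 3) ∧ homogeneousComponent (m - 3) (e * g) = e * l ∧
        e * c ∈ orderIdeal n (m - 1) ∧ homogeneousComponent (m - 1) (e * c) = e * c := by
      rcases hem with rfl | ⟨hm4, hem⟩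
      · simp
      have h1 := hem.mul hc
      rw [show m - 4 + 3 = m - 1 by omega] at h1
      have h2 := mul_mem_orderIdeal (hem.mem_orderIdeal le_rfl) hg
      have h3 := homogeneousComponent_mul_of_order (hem.mem_orderIdeal le_rfl) hg
      rw [show m - 4 + 1 = m - 3 by omega] at h2 h3
      exact ⟨h2, by rw [h3, hem.component_self], h1.mem_orderIdeal le_rfl, h1.component_self⟩
    -- Correcting by the Koszul syzygy of `c` and `g` removes both leading terms.
    refine ⟨a - e * g, b + e * c, by rw [h]; ring, ?_, ?_⟩
    · rw [show m + 1 - 3 = (m - 3) + 1 by omega, orderIdeal_succ]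
      exact ⟨sub_mem ha heg.1, by rw [map_sub, he, heg.2.1, sub_self]⟩
    · rw [show m + 1 - 1 = (m - 1) + 1 by omega, orderIdeal_succ]
      exact ⟨add_mem hb heg.2.2.1, by rw [map_add, hb', heg.2.2.2, neg_add_cancel]⟩

/-- Here `m` is only a lower bound for the order, so zero components need no separate treatment. -/
theorem tangentConeIdeal_le_iff {I J : Ideal (MvPolynomial (Fin 5) ℂ)} :
    tangentConeIdeal I ≤ J ↔
      ∀ f ∈ I, ∀ m, f ∈ orderIdeal 5 m → homogeneousComponent m f ∈ J := by
  rw [tangentConeIdeal, Ideal.span_le]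
  constructor
  · intro h f hf m hm
    by_cases h0 : homogeneousComponent m f = 0
    · rw [h0]
      exact zero_mem J
    · exact h ⟨h0, f, hf, m, mem_orderIdeal_iff.1 hm, rfl⟩
  · rintro h p ⟨_, f, hf, m, hm, rfl⟩
    exact h f hf m (mem_orderIdeal_iff.2 hm)

/-- The tangent cone of the intersection of a cubic cone with a smooth hypersurface whose tangent
hyperplane is not a component of the cone. -/
theorem tangentConeIdeal_eq {c g : MvPolynomial (Fin 5) ℂ} (hc : c.IsHomogeneous 3)
    (hg : g ∈ orderIdeal 5 1) (hl0 : homogeneousComponent 1 g ≠ 0)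
    (hlc : ¬ homogeneousComponent 1 g ∣ c) :
    tangentConeIdeal (Ideal.span {c, g}) = Ideal.span {homogeneousComponent 1 g, c} := by
  apply le_antisymm
  · rw [tangentConeIdeal_le_iff]
    intro f hf m hm
    obtain ⟨a, b, h, -, hb⟩ := exists_combination_of_order hc hg hl0 hlc hf hm
    rw [h, component_combination hc hg hb]
    refine add_mem ?_ ?_
    · split_ifs
      · exact Ideal.mul_mem_left _ _ (Ideal.subset_span (by simp))
      · exact zero_mem _
    · split_ifs
      · exact Ideal.mul_mem_left _ _ (Ideal.subset_span (by simp))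
      · exact zero_mem _
  · have key := tangentConeIdeal_le_iff.1 (le_refl (tangentConeIdeal (Ideal.span {c, g})))
    rw [Ideal.span_le, Set.insert_subset_iff, Set.singleton_subset_iff]
    refine ⟨key g (Ideal.subset_span (by simp)) 1 hg, ?_⟩
    have := key c (Ideal.subset_span (by simp)) 3 (hc.mem_orderIdeal le_rfl)
    rwa [hc.component_self] at this

theorem eval_of_isHomogeneous_zero {n : ℕ} {f : MvPolynomial (Fin n) ℂ} (hf : f.IsHomogeneous 0)
    (x y : Fin n → ℂ) : eval x f = eval y f := by
  rw [← hf.component_self, homogeneousComponent_zero, eval_C, eval_C]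

theorem euler_identity {n m : ℕ} {f : MvPolynomial (Fin n) ℂ} (hf : f.IsHomogeneous m)
    (y : Fin n → ℂ) : ∑ k, y k * gradient f y k = m * eval y f := by
  have := congrArg (eval y) hf.sum_X_mul_pderiv
  simpa [gradient] using this

theorem gradient_of_isHomogeneous_one {n : ℕ} {l : MvPolynomial (Fin n) ℂ} (hl : l.IsHomogeneous 1)
    (x y : Fin n → ℂ) : gradient l x = gradient l y := by
  ext k
  exact eval_of_isHomogeneous_zero hl.pderiv x y

theorem exists_ne_zero_eval_eq_zero {l : MvPolynomial (Fin 5) ℂ} (hl : l.IsHomogeneous 1) :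
    ∃ y : Fin 5 → ℂ, y ≠ 0 ∧ eval y l = 0 := by
  let φ : (Fin 5 → ℂ) →ₗ[ℂ] ℂ := Fintype.linearCombination ℂ (gradient l 0)
  obtain ⟨y, hy, hy0⟩ := (Submodule.ne_bot_iff _).1
    (LinearMap.ker_ne_bot_of_finrank_lt (f := φ) (by simp))
  refine ⟨y, hy0, ?_⟩
  have h1 := euler_identity hl y
  rw [gradient_of_isHomogeneous_one hl y 0] at h1
  have h2 : ∑ k, y k * gradient l 0 k = 0 := by
    simpa [φ, Fintype.linearCombination_apply] using hy
  simpa [h2] using h1.symm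

theorem gradient_mul {n : ℕ} (f g : MvPolynomial (Fin n) ℂ) (y : Fin n → ℂ) :
    gradient (f * g) y = eval y f • gradient g y + eval y g • gradient f y := by
  ext k
  simp [gradient]

theorem gradient_add {n : ℕ} (f g : MvPolynomial (Fin n) ℂ) (y : Fin n → ℂ) :
    gradient (f + g) y = gradient f y + gradient g y := by
  ext k
  simp [gradient]

/-- If `c = l * e`, the gradient of `c` is a multiple of that of `l` everywhere on `l = 0`, which
contains a nonzero vector. -/
theorem not_dvd_of_linearIndependent {l c : MvPolynomial (Fin 5) ℂ} (hl : l.IsHomogeneous 1)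
    (h : ∀ y : Fin 5 → ℂ, y ≠ 0 → eval y l = 0 → eval y c = 0 →
      LinearIndependent ℂ ![gradient l y, gradient c y]) : ¬ l ∣ c := by
  rintro ⟨e, rfl⟩
  obtain ⟨y, hy, hly⟩ := exists_ne_zero_eval_eq_zero hl
  have := h y hy hly (by simp [hly])
  rw [LinearIndependent.pair_iff] at this
  have := this (eval y e) (-1) (by simp [gradient_mul, hly])
  simp at this

theorem eq_C_mul_of_isHomogeneous {l e m : MvPolynomial (Fin 5) ℂ} {k : ℕ}
    (hl : l.IsHomogeneous k) (hm : m.IsHomogeneous k) (h : m = e * l) :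
    ∃ a : ℂ, m = C a * l := by
  refine ⟨coeff 0 e, ?_⟩
  rw [← homogeneousComponent_zero, ← homogeneousComponent_mul_isHomogeneous e hl, ← h, zero_add,
    hm.component_self]

/-- The tangent cone determines its hyperplane and, modulo the equation of the hyperplane, its cubic
up to a scalar. Smoothness may therefore be tested on the linear part of `g` and on `c` instead of
on unknown generators. -/
theorem isConeOverSmoothCubicSurface_iff {c g : MvPolynomial (Fin 5) ℂ} (hc : c.IsHomogeneous 3)
    (hg : g ∈ orderIdeal 5 1) :
    IsConeOverSmoothCubicSurface (tangentConeIdeal (Ideal.span {c, g})) ↔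
      homogeneousComponent 1 g ≠ 0 ∧
      ∀ y : Fin 5 → ℂ, y ≠ 0 → eval y (homogeneousComponent 1 g) = 0 → eval y c = 0 →
        LinearIndependent ℂ ![gradient (homogeneousComponent 1 g) y, gradient c y] := by
  set L := homogeneousComponent 1 g with hL
  have hLh : L.IsHomogeneous 1 := homogeneousComponent_isHomogeneous 1 g
  constructor
  · rintro ⟨l, c', hl, hl0, hc', hJ, hsm⟩
    have key := tangentConeIdeal_le_iff.1 hJ.le
    have hlJ : l ∈ tangentConeIdeal (Ideal.span {c, g}) := hJ ▸ Ideal.subset_span (by simp)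
    have hcJ : c' ∈ tangentConeIdeal (Ideal.span {c, g}) := hJ ▸ Ideal.subset_span (by simp)
    have hL0 : L ≠ 0 := by
      intro h0
      have hg2 : g ∈ orderIdeal 5 2 := orderIdeal_succ.2 ⟨hg, h0⟩
      have hI : Ideal.span {c, g} ≤ orderIdeal 5 2 := by
        rw [Ideal.span_le, Set.insert_subset_iff, Set.singleton_subset_iff]
        exact ⟨hc.mem_orderIdeal (by norm_num), hg2⟩
      have hle : tangentConeIdeal (Ideal.span {c, g}) ≤ orderIdeal 5 2 := by
        rw [tangentConeIdeal_le_iff]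
        intro f hf m hm
        by_cases hm2 : m < 2
        · rw [mem_orderIdeal_iff.1 (hI hf) m hm2]
          exact zero_mem _
        · exact (homogeneousComponent_isHomogeneous m f).mem_orderIdeal (by omega)
      have := mem_orderIdeal_iff.1 (hle hlJ) 1 (by norm_num)
      rw [hl.component_self] at this
      exact hl0 this
    refine ⟨hL0, ?_⟩
    obtain ⟨lam, hlam⟩ : ∃ a : ℂ, L = C a * l := by
      have := key g (Ideal.subset_span (by simp)) 1 hg
      obtain ⟨A, B, hAB⟩ := Ideal.mem_span_pair.1 this
      refine eq_C_mul_of_isHomogeneous (e := homogeneousComponent 0 A) hl hLh ?_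
      rw [← homogeneousComponent_mul_isHomogeneous A hl, zero_add, ← hLh.component_self, hL, ← hAB,
        map_add, homogeneousComponent_mul_of_lt B hc' (by norm_num), add_zero]
    have hlam0 : lam ≠ 0 := by
      rintro rfl
      simp [hlam] at hL0
    have hnot := not_dvd_of_linearIndependent hl hsm
    have hLc : ¬ L ∣ c := by
      rintro ⟨q, hq⟩
      -- If `L` divided `c`, it would divide all initial forms of degree at most three, hence the
      -- cubic `c'`; the initial forms of higher degree do not affect `c'`.
      have hle : tangentConeIdeal (Ideal.span {c, g}) ≤ Ideal.span {L} ⊔ orderIdeal 5 4 := by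
        rw [tangentConeIdeal_le_iff]
        intro f hf m hm
        by_cases hm4 : 4 ≤ m
        · exact Ideal.mem_sup_right ((homogeneousComponent_isHomogeneous m f).mem_orderIdeal hm4)
        obtain ⟨a, b, rfl⟩ := Ideal.mem_span_pair.1 hf
        refine Ideal.mem_sup_left ?_
        rw [component_combination hc hg
          (order_of_combination_le_three hc hg hL0 (by omega) hm), Ideal.mem_span_singleton]
        refine dvd_add ?_ ?_
        · split_ifs
          · exact Dvd.dvd.mul_left ⟨q, hq⟩ _
          · exact dvd_zero _
        · split_ifs
          · exact dvd_mul_left _ _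
          · exact dvd_zero _
      obtain ⟨x, hx, r, hr, hxr⟩ := Submodule.mem_sup.1 (hle hcJ)
      obtain ⟨e, rfl⟩ := Ideal.mem_span_singleton.1 hx
      apply hnot
      have h1 : c' = homogeneousComponent 2 e * L := by
        rw [← homogeneousComponent_mul_isHomogeneous e hLh]
        conv_lhs => rw [← hc'.component_self, ← hxr, map_add,
          mem_orderIdeal_iff.1 hr 3 (by norm_num), add_zero, mul_comm]
      rw [h1, hlam]
      exact Dvd.dvd.mul_left (dvd_mul_left _ _) _
    have hcmem := key c (Ideal.subset_span (by simp)) 3 (hc.mem_orderIdeal le_rfl)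
    rw [hc.component_self] at hcmem
    obtain ⟨A, B, hAB⟩ := Ideal.mem_span_pair.1 hcmem
    -- The cubic part of `A * l + B * c' = c`. On `l = 0` the gradients of `c` and `κ c'` then
    -- differ by a multiple of that of `l`.
    obtain ⟨κ, hκ⟩ : ∃ κ : ℂ, c = homogeneousComponent 2 A * l + C κ * c' := by
      refine ⟨coeff 0 B, ?_⟩
      rw [← homogeneousComponent_mul_isHomogeneous A hl, ← homogeneousComponent_zero,
        ← homogeneousComponent_mul_isHomogeneous B hc', zero_add, ← map_add, hAB,
        hc.component_self]
    have hκ0 : κ ≠ 0 := by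
      rintro rfl
      apply hLc
      rw [hκ, hlam]
      refine ⟨C lam⁻¹ * homogeneousComponent 2 A, ?_⟩
      have : (C lam * C lam⁻¹ : MvPolynomial (Fin 5) ℂ) = 1 := by
        rw [← C_mul, mul_inv_cancel₀ hlam0, C_1]
      rw [C_0]
      linear_combination (-homogeneousComponent 2 A * l) * this
    intro y hy hLy hcy
    have hly : eval y l = 0 := by simpa [hlam, hlam0] using hLy
    have hcy' : eval y c' = 0 := by simpa [hκ, hly, hκ0] using hcy
    have := hsm y hy hly hcy'
    have gC : ∀ a : ℂ, gradient (C a : MvPolynomial (Fin 5) ℂ) y = 0 := fun a => by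
      ext k; simp [gradient]
    have g1 : gradient L y = lam • gradient l y := by simp [hlam, gradient_mul, gC]
    have g2 : gradient c y = eval y (homogeneousComponent 2 A) • gradient l y +
        κ • gradient c' y := by
      conv_lhs => rw [hκ]
      simp [gradient_mul, gradient_add, gC, hly]
    rw [LinearIndependent.pair_iff] at this ⊢
    intro s t hst
    rw [g1, g2] at hst
    have h2 := this (s * lam + t * eval y (homogeneousComponent 2 A)) (t * κ) (by
      rw [← hst]; module)
    have ht : t = 0 := by simpa [hκ0] using h2.2
    have hs := h2.1
    rw [ht, zero_mul, add_zero] at hs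
    exact ⟨by simpa [hlam0] using hs, ht⟩
  · rintro ⟨hL0, hsm⟩
    exact ⟨L, c, hLh, hL0, hc,
      tangentConeIdeal_eq hc hg hL0 (not_dvd_of_linearIndependent hLh hsm), hsm⟩

end InitialForms

/-! ### Cubic forms and symmetric trilinear forms -/

section PolarForms

variable {n : ℕ}

/-- The trilinear form with given coefficients. -/
noncomputable def trilinearOfCoeffs (c : Fin n → Fin n → Fin n → ℂ) :
    TrilinearForm (Fin n → ℂ) :=
  ∑ i, ∑ j, ∑ k, c i j k • (LinearMap.proj i : (Fin n → ℂ) →ₗ[ℂ] ℂ).smulRight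
    ((LinearMap.proj j : (Fin n → ℂ) →ₗ[ℂ] ℂ).smulRight (LinearMap.proj k : (Fin n → ℂ) →ₗ[ℂ] ℂ))

theorem trilinearOfCoeffs_apply (c : Fin n → Fin n → Fin n → ℂ) (u v w : Fin n → ℂ) :
    trilinearOfCoeffs c u v w = ∑ i, ∑ j, ∑ k, c i j k * (u i * (v j * w k)) := by
  simp [trilinearOfCoeffs, LinearMap.sum_apply]

/-- `T` is the symmetric trilinear form whose restriction to the diagonal is the cubic `f`. -/
structure IsPolarForm (f : MvPolynomial (Fin n) ℂ) (T : TrilinearForm (Fin n → ℂ)) : Prop where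
  symm : IsSymmetric T
  eval_eq : ∀ y, eval y f = T y y y

theorem IsPolarForm.combination {f g : MvPolynomial (Fin n) ℂ} {S T : TrilinearForm (Fin n → ℂ)}
    (hf : IsPolarForm f S) (hg : IsPolarForm g T) (a b : ℂ) :
    IsPolarForm (C a * f + C b * g) (a • S + b • T) where
  symm := hf.symm.combination hg.symm a b
  eval_eq y := by simp [hf.eval_eq, hg.eval_eq]

/-- Polarisation. -/
theorem IsSymmetric.apply_diag {V : Type*} [AddCommGroup V] [Module ℂ V] {S T : TrilinearForm V}
    (hS : IsSymmetric S) (hT : IsSymmetric T) (h : ∀ u, S u u u = T u u u) (u v : V) :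
    S u u v = T u u v := by
  have key : ∀ {T : TrilinearForm V}, IsSymmetric T →
      6 * T u u v = T (u + v) (u + v) (u + v) - T (u - v) (u - v) (u - v) - 2 * T v v v := by
    intro T hT
    have e1 : T u v u = T u u v := hT.swap_right _ _ _
    have e2 : T v u u = T u u v := by rw [hT.swap_left, e1]
    have e3 : T v u v = T v v u := hT.swap_right _ _ _
    have e4 : T u v v = T v v u := by rw [hT.swap_left, e3]
    simp only [map_add, map_sub, LinearMap.add_apply, LinearMap.sub_apply, e1, e2, e3, e4]
    ring
  have h1 := key hS
  have h2 := key hT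
  rw [h, h, h, ← h2] at h1
  linear_combination h1 / 6

theorem pderiv_comm (f : MvPolynomial (Fin n) ℂ) (i j : Fin n) :
    pderiv i (pderiv j f) = pderiv j (pderiv i f) := by
  have : ⁅(pderiv i : Derivation ℂ (MvPolynomial (Fin n) ℂ) (MvPolynomial (Fin n) ℂ)),
      (pderiv j : Derivation ℂ (MvPolynomial (Fin n) ℂ) (MvPolynomial (Fin n) ℂ))⁆ = 0 := by
    refine derivation_ext fun k => ?_
    simp [Derivation.commutator_apply, pderiv_X, Pi.single_apply, apply_ite]
  have h := DFunLike.congr_fun this f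
  rw [Derivation.commutator_apply] at h
  exact sub_eq_zero.1 h

/-- The coefficients are the constant third derivatives divided by six. Euler's identity for the
first and second derivatives gives the gradient, and for `f` itself the values on the diagonal. -/
theorem exists_isPolarForm {f : MvPolynomial (Fin n) ℂ} (hf : f.IsHomogeneous 3) :
    ∃ T, IsPolarForm f T ∧ ∀ y w, ∑ i, gradient f y i * w i = 3 * T y y w := by
  let c : Fin n → Fin n → Fin n → ℂ := fun i j k => eval 0 (pderiv i (pderiv j (pderiv k f))) / 6
  have hsym : IsSymmetric (trilinearOfCoeffs c) := by
    constructor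
    · intro u v w
      simp only [trilinearOfCoeffs_apply]
      rw [Finset.sum_comm]
      refine Finset.sum_congr rfl fun i _ => Finset.sum_congr rfl fun j _ =>
        Finset.sum_congr rfl fun k _ => ?_
      simp only [c]
      rw [pderiv_comm _ i j]
      ring
    · intro u v w
      simp only [trilinearOfCoeffs_apply]
      refine Finset.sum_congr rfl fun i _ => ?_
      rw [Finset.sum_comm]
      refine Finset.sum_congr rfl fun j _ => Finset.sum_congr rfl fun k _ => ?_
      simp only [c]
      rw [pderiv_comm _ j k]
      ring
  have hgrad : ∀ y w, ∑ i, gradient f y i * w i = 3 * trilinearOfCoeffs c y y w := by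
    intro y w
    have h1 : ∀ k, 2 * gradient f y k =
        ∑ j, y j * ∑ i, y i * eval 0 (pderiv i (pderiv j (pderiv k f))) := by
      intro k
      have e1 := euler_identity (f := pderiv k f) hf.pderiv y
      have e2 : ∀ j, gradient (pderiv k f) y j =
          ∑ i, y i * eval 0 (pderiv i (pderiv j (pderiv k f))) := by
        intro j
        have e3 := euler_identity (f := pderiv j (pderiv k f)) hf.pderiv.pderiv y
        simp only [Nat.add_one_sub_one, Nat.cast_one, one_mul, gradient] at e3
        rw [gradient, ← e3]
        exact Finset.sum_congr rfl fun i _ => by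
          rw [eval_of_isHomogeneous_zero hf.pderiv.pderiv.pderiv y 0]
      simp only [e2] at e1
      rw [e1]
      norm_num [gradient]
    rw [trilinearOfCoeffs_apply]
    have : ∀ k, gradient f y k * w k = 3 * ∑ j, ∑ i, c i j k * (y i * (y j * w k)) := by
      intro k
      have : gradient f y k = (2 * gradient f y k) / 2 := by ring
      rw [this, h1 k, Finset.sum_div, Finset.sum_mul, Finset.mul_sum]
      refine Finset.sum_congr rfl fun j _ => ?_
      rw [Finset.mul_sum, Finset.mul_sum, Finset.sum_div, Finset.sum_mul]
      refine Finset.sum_congr rfl fun i _ => ?_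
      simp only [c]
      ring
    simp only [this]
    rw [← Finset.mul_sum]
    refine congrArg (3 * ·) ?_
    refine Finset.sum_comm.trans ?_
    refine (Finset.sum_congr rfl fun j _ => Finset.sum_comm).trans ?_
    exact Finset.sum_comm
  refine ⟨trilinearOfCoeffs c, ⟨hsym, fun y => ?_⟩, hgrad⟩
  have h1 := euler_identity hf y
  have h2 := hgrad y y
  simp only [mul_comm (gradient f y _)] at h2
  rw [h1] at h2
  push_cast at h2
  linear_combination h2 / 3

theorem IsPolarForm.gradient_eq {f : MvPolynomial (Fin n) ℂ} {T : TrilinearForm (Fin n → ℂ)}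
    (hT : IsPolarForm f T) (hf : f.IsHomogeneous 3) (y w : Fin n → ℂ) :
    ∑ i, gradient f y i * w i = 3 * T y y w := by
  obtain ⟨S, hS, h⟩ := exists_isPolarForm hf
  rw [h, hS.symm.apply_diag hT.symm fun u => by rw [← hS.eval_eq, hT.eval_eq]]

theorem map_eq_sum_single {M : Type*} [AddCommGroup M] [Module ℂ M] (φ : (Fin n → ℂ) →ₗ[ℂ] M)
    (y : Fin n → ℂ) : φ y = ∑ i, y i • φ (Pi.single i 1) := by
  have : y = ∑ i, y i • (Pi.single i 1 : Fin n → ℂ) := by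
    ext k
    simp [Finset.sum_apply, Pi.single_apply]
  conv_lhs => rw [this]
  simp

/-- The linear form of a functional. -/
noncomputable def linearPolynomial (φ : (Fin n → ℂ) →ₗ[ℂ] ℂ) : MvPolynomial (Fin n) ℂ :=
  ∑ i, X i * C (φ (Pi.single i 1))

/-- The quadratic form of a bilinear form. -/
noncomputable def quadraticPolynomial (B : (Fin n → ℂ) →ₗ[ℂ] (Fin n → ℂ) →ₗ[ℂ] ℂ) :
    MvPolynomial (Fin n) ℂ :=
  ∑ i, X i * linearPolynomial (B (Pi.single i 1))

/-- The cubic form of a trilinear form. -/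
noncomputable def cubicPolynomial (T : TrilinearForm (Fin n → ℂ)) : MvPolynomial (Fin n) ℂ :=
  ∑ i, X i * quadraticPolynomial (T (Pi.single i 1))

theorem eval_linearPolynomial (φ : (Fin n → ℂ) →ₗ[ℂ] ℂ) (y : Fin n → ℂ) :
    eval y (linearPolynomial φ) = φ y := by
  rw [map_eq_sum_single φ]
  simp [linearPolynomial]

theorem eval_quadraticPolynomial (B : (Fin n → ℂ) →ₗ[ℂ] (Fin n → ℂ) →ₗ[ℂ] ℂ) (y : Fin n → ℂ) :
    eval y (quadraticPolynomial B) = B y y := by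
  rw [map_eq_sum_single B]
  simp [quadraticPolynomial, eval_linearPolynomial]

theorem eval_cubicPolynomial (T : TrilinearForm (Fin n → ℂ)) (y : Fin n → ℂ) :
    eval y (cubicPolynomial T) = T y y y := by
  rw [map_eq_sum_single T]
  simp [cubicPolynomial, eval_quadraticPolynomial]

theorem isHomogeneous_linearPolynomial (φ : (Fin n → ℂ) →ₗ[ℂ] ℂ) :
    (linearPolynomial φ).IsHomogeneous 1 :=
  IsHomogeneous.sum _ _ _ fun i _ => (isHomogeneous_X ℂ i).mul (isHomogeneous_C _ _)

theorem isHomogeneous_quadraticPolynomial (B : (Fin n → ℂ) →ₗ[ℂ] (Fin n → ℂ) →ₗ[ℂ] ℂ) :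
    (quadraticPolynomial B).IsHomogeneous 2 :=
  IsHomogeneous.sum _ _ _ fun i _ => (isHomogeneous_X ℂ i).mul (isHomogeneous_linearPolynomial _)

theorem isHomogeneous_cubicPolynomial (T : TrilinearForm (Fin n → ℂ)) :
    (cubicPolynomial T).IsHomogeneous 3 :=
  IsHomogeneous.sum _ _ _ fun i _ =>
    (isHomogeneous_X ℂ i).mul (isHomogeneous_quadraticPolynomial _)

/-- Gradients are known through their pairings with vectors (`IsPolarForm.gradient_eq`); this puts
independence in the same terms. -/
theorem linearIndependent_pair_iff_forall {a b : Fin n → ℂ} :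
    LinearIndependent ℂ ![a, b] ↔
      ∀ s t : ℂ, (∀ w : Fin n → ℂ, s * ∑ i, a i * w i + t * ∑ i, b i * w i = 0) → s = 0 ∧ t = 0 := by
  rw [LinearIndependent.pair_iff]
  refine forall₂_congr fun s t => imp_congr_left ?_
  constructor
  · intro h w
    rw [Finset.mul_sum, Finset.mul_sum, ← Finset.sum_add_distrib]
    refine Finset.sum_eq_zero fun i _ => ?_
    have := congrFun h i
    simp only [Pi.add_apply, Pi.smul_apply, smul_eq_mul, Pi.zero_apply] at this
    linear_combination w i * this
  · intro h
    ext i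
    simpa [Pi.single_apply] using h (Pi.single i 1)

/-- The restriction of a trilinear form along a linear map. -/
def TrilinearForm.restrict {V W : Type*} [AddCommGroup V] [Module ℂ V] [AddCommGroup W]
    [Module ℂ W] (T : TrilinearForm V) (φ : W →ₗ[ℂ] V) : TrilinearForm W where
  toFun u := (T (φ u)).compl₁₂ φ φ
  map_add' u v := by ext; simp
  map_smul' a u := by ext; simp

@[simp]
theorem TrilinearForm.restrict_apply {V W : Type*} [AddCommGroup V] [Module ℂ V] [AddCommGroup W]
    [Module ℂ W] (T : TrilinearForm V) (φ : W →ₗ[ℂ] V) (u v w : W) :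
    T.restrict φ u v w = T (φ u) (φ v) (φ w) := rfl

theorem IsSymmetric.restrict {V W : Type*} [AddCommGroup V] [Module ℂ V] [AddCommGroup W]
    [Module ℂ W] {T : TrilinearForm V} (hT : IsSymmetric T) (φ : W →ₗ[ℂ] V) :
    IsSymmetric (T.restrict φ) where
  swap_left _ _ _ := hT.swap_left _ _ _
  swap_right _ _ _ := hT.swap_right _ _ _

theorem isPolarForm_cubicPolynomial {T : TrilinearForm (Fin n → ℂ)} (hT : IsSymmetric T) :
    IsPolarForm (cubicPolynomial T) T := ⟨hT, eval_cubicPolynomial T⟩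

end PolarForms

/-! ### Affine charts, triple points as vertices, tangent cones of the intersection -/

section Localization

/-- The coordinate hyperplane `x i = 0`. -/
def hyperplaneInclusion (i : Fin 6) : (Fin 5 → ℂ) →ₗ[ℂ] (Fin 6 → ℂ) where
  toFun y := i.insertNth (α := fun _ => ℂ) 0 y
  map_add' u v := by
    ext k
    refine Fin.succAboveCases i ?_ (fun j => ?_) k <;> simp
  map_smul' a u := by
    ext k
    refine Fin.succAboveCases i ?_ (fun j => ?_) k <;> simp

theorem hyperplaneInclusion_same (i : Fin 6) (y : Fin 5 → ℂ) : hyperplaneInclusion i y i = 0 := by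
  simp [hyperplaneInclusion]

theorem hyperplaneInclusion_succAbove (i : Fin 6) (y : Fin 5 → ℂ) (j : Fin 5) :
    hyperplaneInclusion i y (i.succAbove j) = y j := by
  simp [hyperplaneInclusion]

theorem hyperplaneInclusion_ne_smul {i : Fin 6} {v : Fin 6 → ℂ} (hv : v i ≠ 0) {y : Fin 5 → ℂ}
    (hy : y ≠ 0) (c : ℂ) : hyperplaneInclusion i y ≠ c • v := by
  intro h
  have h1 := congrFun h i
  rw [hyperplaneInclusion_same] at h1
  have hc : c = 0 := by simpa [hv] using h1.symm
  apply hy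
  ext j
  rw [← hyperplaneInclusion_succAbove i y j, h, hc]
  simp

theorem exists_eq_hyperplaneInclusion_add {i : Fin 6} {v : Fin 6 → ℂ} (hv : v i ≠ 0)
    (w : Fin 6 → ℂ) : ∃ (y : Fin 5 → ℂ) (c : ℂ), w = hyperplaneInclusion i y + c • v := by
  refine ⟨fun j => w (i.succAbove j) - w i / v i * v (i.succAbove j), w i / v i, ?_⟩
  ext k
  refine Fin.succAboveCases i ?_ (fun j => ?_) k
  · simp [hyperplaneInclusion_same, hv]
  · simp [hyperplaneInclusion_succAbove]

theorem eval_localize {i : Fin 6} {v : Fin 6 → ℂ} (hv : v i ≠ 0) (y : Fin 5 → ℂ)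
    (H : MvPolynomial (Fin 6) ℂ) :
    eval y (localize v i H) = eval ((v i)⁻¹ • v + hyperplaneInclusion i y) H := by
  have : (fun k => eval y ((i.insertNth (α := fun _ => MvPolynomial (Fin 5) ℂ) 1
    (fun j => X j + C (v (i.succAbove j) / v i))) k)) = (v i)⁻¹ • v + hyperplaneInclusion i y := by
    ext k
    refine Fin.succAboveCases i ?_ (fun j => ?_) k
    · simp [hyperplaneInclusion_same, hv]
    · simp [hyperplaneInclusion_succAbove]
      ring
  rw [← this, localize]
  induction H using MvPolynomial.induction_on with
  | C a => simp
  | add p q hp hq => simp only [map_add, hp, hq]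
  | mul_X p k hp => simp only [map_mul, hp, aeval_X, eval_X]

/-- The Taylor expansion of a cubic form at a point. -/
theorem localize_eq {i : Fin 6} {v : Fin 6 → ℂ} (hv : v i ≠ 0) {H : MvPolynomial (Fin 6) ℂ}
    {T : TrilinearForm (Fin 6 → ℂ)} (hT : IsPolarForm H T) :
    localize v i H = C ((v i)⁻¹ ^ 3 * T v v v) +
      linearPolynomial ((3 * (v i)⁻¹ ^ 2) • (T v v).comp (hyperplaneInclusion i)) +
      quadraticPolynomial ((3 * (v i)⁻¹) •
        (T v).compl₁₂ (hyperplaneInclusion i) (hyperplaneInclusion i)) +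
      cubicPolynomial (T.restrict (hyperplaneInclusion i)) := by
  refine MvPolynomial.funext fun y => ?_
  rw [eval_localize hv, hT.eval_eq]
  simp only [map_add, eval_linearPolynomial, eval_quadraticPolynomial, eval_cubicPolynomial, eval_C]
  set u := hyperplaneInclusion i y
  have e1 : T v u v = T v v u := hT.symm.swap_right _ _ _
  have e2 : T u v v = T v v u := by rw [hT.symm.swap_left, e1]
  have e3 : T u u v = T v u u := by rw [hT.symm.swap_right, hT.symm.swap_left]
  have e4 : T u v u = T v u u := by rw [hT.symm.swap_left]
  simp only [map_smul, LinearMap.add_apply, LinearMap.smul_apply, smul_eq_mul, e1, e2,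
    e3, e4, LinearMap.comp_apply, LinearMap.compl₁₂_apply, TrilinearForm.restrict_apply]
  ring

theorem _root_.MvPolynomial.IsHomogeneous.component_of_ne {n k m : ℕ}
    {f : MvPolynomial (Fin n) ℂ} (hf : f.IsHomogeneous m) (h : k ≠ m) :
    homogeneousComponent k f = 0 := by
  rw [homogeneousComponent_of_mem (n := m) hf, if_neg h]

theorem components_localize {i : Fin 6} {v : Fin 6 → ℂ} (hv : v i ≠ 0)
    {H : MvPolynomial (Fin 6) ℂ} {T : TrilinearForm (Fin 6 → ℂ)} (hT : IsPolarForm H T) :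
    homogeneousComponent 0 (localize v i H) = C ((v i)⁻¹ ^ 3 * T v v v) ∧
    homogeneousComponent 1 (localize v i H) =
      linearPolynomial ((3 * (v i)⁻¹ ^ 2) • (T v v).comp (hyperplaneInclusion i)) ∧
    homogeneousComponent 2 (localize v i H) =
      quadraticPolynomial ((3 * (v i)⁻¹) •
        (T v).compl₁₂ (hyperplaneInclusion i) (hyperplaneInclusion i)) := by
  rw [localize_eq hv hT]
  simp only [map_add]
  have h0 := isHomogeneous_C (Fin 5) ((v i)⁻¹ ^ 3 * T v v v)
  have h1 := isHomogeneous_linearPolynomial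
    ((3 * (v i)⁻¹ ^ 2) • (T v v).comp (hyperplaneInclusion i))
  have h2 := isHomogeneous_quadraticPolynomial ((3 * (v i)⁻¹) •
        (T v).compl₁₂ (hyperplaneInclusion i) (hyperplaneInclusion i))
  have h3 := isHomogeneous_cubicPolynomial (T.restrict (hyperplaneInclusion i))
  refine ⟨?_, ?_, ?_⟩
  · rw [h0.component_self, h1.component_of_ne (by norm_num), h2.component_of_ne (by norm_num),
      h3.component_of_ne (by norm_num)]
    simp
  · rw [h0.component_of_ne (by norm_num), h1.component_self, h2.component_of_ne (by norm_num),
      h3.component_of_ne (by norm_num)]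
    simp
  · rw [h0.component_of_ne (by norm_num), h1.component_of_ne (by norm_num), h2.component_self,
      h3.component_of_ne (by norm_num)]
    simp

theorem localize_of_vertex {i : Fin 6} {v : Fin 6 → ℂ} (hv : v i ≠ 0)
    {H : MvPolynomial (Fin 6) ℂ} {T : TrilinearForm (Fin 6 → ℂ)} (hT : IsPolarForm H T)
    (h : T v = 0) : localize v i H = cubicPolynomial (T.restrict (hyperplaneInclusion i)) := by
  refine MvPolynomial.funext fun y => ?_
  rw [localize_eq hv hT]
  simp [h, eval_linearPolynomial, eval_quadraticPolynomial]

/-- A point of multiplicity three of a cubic hypersurface is a vertex. -/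
theorem isTriplePointOfHypersurface_iff {H : MvPolynomial (Fin 6) ℂ}
    {T : TrilinearForm (Fin 6 → ℂ)} (hT : IsPolarForm H T) (hH : H ≠ 0) (P : P5) :
    IsTriplePointOfHypersurface H P ↔ T P.rep = 0 := by
  constructor
  · rintro ⟨i, hi, h, -⟩
    obtain ⟨c0, c1, c2⟩ := components_localize hi hT
    rw [h 0 (by norm_num)] at c0
    rw [h 1 (by norm_num)] at c1
    rw [h 2 (by norm_num)] at c2
    set v := P.rep
    have t0 : T v v v = 0 := by simpa [hi] using c0.symm
    have t1 : ∀ y, T v v (hyperplaneInclusion i y) = 0 := fun y => by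
      simpa [eval_linearPolynomial, hi] using (congrArg (eval y) c1).symm
    have t2 : ∀ y, T v (hyperplaneInclusion i y) (hyperplaneInclusion i y) = 0 := fun y => by
      simpa [eval_quadraticPolynomial, hi] using (congrArg (eval y) c2).symm
    have t1' : ∀ w, T v v w = 0 := by
      intro w
      obtain ⟨y, c, rfl⟩ := exists_eq_hyperplaneInclusion_add hi w
      simp [t0, t1]
    have t1'' : ∀ w, T v w v = 0 := fun w => by rw [hT.symm.swap_right, t1']
    have t2' : ∀ w, T v w w = 0 := by
      intro w
      obtain ⟨y, c, rfl⟩ := exists_eq_hyperplaneInclusion_add hi w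
      simp [t1', t2, t1'']
    ext u w
    -- Polarisation: the symmetric bilinear form `T v` vanishes on the diagonal.
    have h1 := t2' (Pi.single u 1 + Pi.single w 1)
    have h2 : T v (Pi.single w 1) (Pi.single u 1) = T v (Pi.single u 1) (Pi.single w 1) :=
      hT.symm.swap_right _ _ _
    simp only [map_add, LinearMap.add_apply, t2', h2] at h1
    simp
    linear_combination h1 / 2
  · intro h
    obtain ⟨i, hi⟩ := Function.ne_iff.1 P.rep_nonzero
    have hloc := localize_of_vertex hi hT h
    have hom := isHomogeneous_cubicPolynomial (T.restrict (hyperplaneInclusion i))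
    refine ⟨i, hi, fun m hm => by rw [hloc, hom.component_of_ne (by omega)], ?_⟩
    rw [hloc, hom.component_self]
    intro h0
    apply hH
    refine MvPolynomial.funext fun w => ?_
    obtain ⟨y, c, rfl⟩ := exists_eq_hyperplaneInclusion_add hi w
    have h1 := congrArg (eval y) h0
    rw [eval_cubicPolynomial] at h1
    have s1 : ∀ u w, T u P.rep w = 0 := fun u w => by rw [hT.symm.swap_left]; simp [h]
    have s2 : ∀ u w, T u w P.rep = 0 := fun u w => by rw [hT.symm.swap_right, s1]
    rw [hT.eval_eq]
    simpa [h, s1, s2] using h1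

/-- At the vertex `v` the local equation of `H` is purely cubic, and that of `K` begins with a
multiple of `k v v`. Both `k v v` and every `h u u` vanish on `v`, so restricting to the complement
`x i = 0` of the line of `v` loses nothing. -/
theorem isConeOverSmoothCubicSurface_iff_isOrdinaryVertex {H K : MvPolynomial (Fin 6) ℂ}
    {h k : TrilinearForm (Fin 6 → ℂ)} (hh : IsPolarForm H h) (hk : IsPolarForm K k)
    {v : Fin 6 → ℂ} {i : Fin 6} (hi : v i ≠ 0) (hv : h v = 0) (hkv : k v v v = 0) :
    IsConeOverSmoothCubicSurface
      (tangentConeIdeal (Ideal.span {localize v i H, localize v i K})) ↔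
      IsOrdinaryVertex h k v := by
  obtain ⟨c0, c1, -⟩ := components_localize hi hk
  have hg : localize v i K ∈ orderIdeal 5 1 := by
    refine orderIdeal_succ.2 ⟨orderIdeal_zero _, ?_⟩
    rw [c0, hkv]
    simp
  rw [localize_of_vertex hi hh hv,
    isConeOverSmoothCubicSurface_iff (isHomogeneous_cubicPolynomial _) hg, c1]
  set ι := hyperplaneInclusion i with hι
  set a : ℂ := 3 * (v i)⁻¹ ^ 2 with ha
  have ha0 : a ≠ 0 := by simp [ha, hi]
  have s1 : ∀ u w, h u v w = 0 := fun u w => by rw [hh.symm.swap_left]; simp [hv]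
  have s2 : ∀ u w, h u w v = 0 := fun u w => by rw [hh.symm.swap_right, s1]
  have hLI : ∀ y, LinearIndependent ℂ ![gradient (linearPolynomial (a • (k v v).comp ι)) y,
      gradient (cubicPolynomial (h.restrict ι)) y] ↔
      LinearIndependent ℂ ![h (ι y) (ι y), k v v] := by
    intro y
    have e1 : ∀ w, ∑ j, gradient (linearPolynomial (a • (k v v).comp ι)) y j * w j =
        a * k v v (ι w) := by
      intro w
      have hom := isHomogeneous_linearPolynomial (a • (k v v).comp ι)
      rw [gradient_of_isHomogeneous_one hom y w]
      have := euler_identity hom w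
      simp only [mul_comm (w _), eval_linearPolynomial] at this
      simpa using this
    have e2 := (isPolarForm_cubicPolynomial (hh.symm.restrict ι)).gradient_eq
      (isHomogeneous_cubicPolynomial _) y
    rw [linearIndependent_pair_iff_forall, LinearIndependent.pair_iff]
    simp only [e1, e2, TrilinearForm.restrict_apply]
    constructor
    · intro H s t hst
      have := H (t / a) (s / 3) fun w => by
        have := LinearMap.congr_fun hst (ι w)
        simp only [LinearMap.add_apply, LinearMap.smul_apply, smul_eq_mul,
          LinearMap.zero_apply] at this
        rw [← this]
        field_simp
        ring
      simpa [ha0, and_comm] using this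
    · intro H s t hst
      have := H (3 * t) (a * s) (by
        refine LinearMap.ext fun w => ?_
        obtain ⟨z, c, rfl⟩ := exists_eq_hyperplaneInclusion_add hi w
        simp [s2, hkv]
        linear_combination hst z)
      simpa [ha0, and_comm] using this
  constructor
  · rintro ⟨hL, hsm⟩
    refine ⟨?_, hv, hkv, ?_, ?_⟩
    · rintro rfl
      simp at hi
    · intro h0
      apply hL
      refine MvPolynomial.funext fun y => ?_
      simp [eval_linearPolynomial, h0]
    · intro w hw hkw hhw
      obtain ⟨y, c, rfl⟩ := exists_eq_hyperplaneInclusion_add hi w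
      have hy : y ≠ 0 := by
        rintro rfl
        exact hw c (by simp)
      have := (hLI y).1 (hsm y hy (by
          rw [eval_linearPolynomial]
          simpa [hkv] using Or.inr hkw) (by
          rw [eval_cubicPolynomial]
          simpa [hv, s1, s2, ι] using hhw))
      have e : h (ι y + c • v) (ι y + c • v) = h (ι y) (ι y) := by
        ext w
        simp [hv, s1]
      rwa [e]
  · intro H
    refine ⟨?_, ?_⟩
    · intro h0
      apply H.tangent_ne_zero
      refine LinearMap.ext fun w => ?_
      obtain ⟨y, c, rfl⟩ := exists_eq_hyperplaneInclusion_add hi w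
      have := congrArg (eval y) h0
      rw [eval_linearPolynomial] at this
      simpa [ha0, hkv] using this
    · intro y hy h1 h2
      rw [eval_linearPolynomial] at h1
      rw [eval_cubicPolynomial] at h2
      exact (hLI y).2 (H.smooth _ (hyperplaneInclusion_ne_smul hi hy) (by simpa [ha0] using h1) h2)

end Localization

/-! ### At most three cones with ordinary vertices in a pencil -/

section Pencil

variable {V : Type*} [AddCommGroup V] [Module ℂ V]

/-- `P` is an ordinary vertex of the member `α f + β g` of the pencil. -/
def IsVertexOfMember (f g : TrilinearForm V) (α β : ℂ) (P : V) : Prop :=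
  -- Every second generator is allowed; for `α = β = 0` the condition is vacuous.
  ∀ γ δ : ℂ, α * δ - β * γ ≠ 0 → IsOrdinaryVertex (α • f + β • g) (γ • f + δ • g) P

/-- At most three members of a pencil of cubics in `P5` have ordinary vertices. -/
theorem not_four_members [FiniteDimensional ℂ V] (hV : Module.finrank ℂ V = 6)
    {f g : TrilinearForm V} (hf : IsSymmetric f) (hg : IsSymmetric g)
    (α β : Fin 4 → ℂ) (P : Fin 4 → V) (hP : ∀ i, IsVertexOfMember f g (α i) (β i) (P i))
    (hd : ∀ i j, i ≠ j → α i * β j - β i * α j ≠ 0) : False := by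
  let d : Fin 4 → Fin 4 → ℂ := fun i j => α i * β j - β i * α j
  let h : Fin 4 → TrilinearForm V := fun i => α i • f + β i • g
  have hsym : ∀ (a : ℂ) i, IsSymmetric (a • h i) := fun a i => by
    have := hf.combination hg (a * α i) (a * β i)
    rwa [← smul_smul, ← smul_smul, ← smul_add] at this
  have hv : ∀ (a b : ℂ) i j, i ≠ j → a ≠ 0 → b ≠ 0 →
      IsOrdinaryVertex (a • h i) (b • h j) (P i) := by
    intro a b i j hij ha hb
    have := (hP i (α j) (β j) (hd i j hij)).change_basis (b := 0) ha hb
    rwa [zero_smul, zero_add] at this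
  -- The minors are the coefficients of the linear relation among three vectors of a plane.
  have H : IsVertexTriple (d 1 2 • h 0) (d 2 0 • h 1) (d 0 1 • h 2) (P 0) (P 1) (P 2) := by
    refine ⟨hsym _ _, hsym _ _, hsym _ _, fun u v w => ?_,
      hv _ _ _ _ (by decide) (hd _ _ (by decide)) (hd _ _ (by decide)),
      hv _ _ _ _ (by decide) (hd _ _ (by decide)) (hd _ _ (by decide)),
      hv _ _ _ _ (by decide) (hd _ _ (by decide)) (hd _ _ (by decide))⟩
    simp [d, h]
    ring
  have hvert : h 3 (P 3) = 0 := (hv 1 1 3 0 (by decide) one_ne_zero one_ne_zero).vertex ▸ by simp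
  refine (hv 1 1 3 0 (by decide) one_ne_zero one_ne_zero).ne_zero
    (H.no_fourth hV (α := - (d 1 3 * d 2 0)) (β := - (d 3 0 * d 1 2))
      (neg_ne_zero.2 (mul_ne_zero (hd _ _ (by decide)) (hd _ _ (by decide))))
      (neg_ne_zero.2 (mul_ne_zero (hd _ _ (by decide)) (hd _ _ (by decide)))) ?_ ?_)
  -- By the Plücker relation the two coefficients differ by `d 0 1 * d 2 3`.
  · intro e
    apply mul_ne_zero (hd 0 1 (by decide)) (hd 2 3 (by decide))
    simp only [d] at e
    linear_combination e
  · have e : (-(d 1 3 * d 2 0)) • (d 1 2 • h 0) + (-(d 3 0 * d 1 2)) • (d 2 0 • h 1) =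
        (d 1 2 * d 2 0 * d 0 1) • h 3 := by
      simp only [h, smul_add, smul_smul]
      have e1 : -(d 1 3 * d 2 0) * (d 1 2 * α 0) + -(d 3 0 * d 1 2) * (d 2 0 * α 1) =
          d 1 2 * d 2 0 * d 0 1 * α 3 := by simp only [d]; ring
      have e2 : -(d 1 3 * d 2 0) * (d 1 2 * β 0) + -(d 3 0 * d 1 2) * (d 2 0 * β 1) =
          d 1 2 * d 2 0 * d 0 1 * β 3 := by simp only [d]; ring
      rw [← e1, ← e2]
      module
    have := LinearMap.congr_fun e (P 3)
    simp only [LinearMap.add_apply, LinearMap.smul_apply, hvert, smul_zero] at this ⊢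
    exact this

end Pencil

/-! ### The bound of nine points -/

section UpperBound

variable {F G : MvPolynomial (Fin 6) ℂ} {f g : TrilinearForm (Fin 6 → ℂ)}

theorem rep_ne_smul {P Q : P5} (h : P ≠ Q) (c : ℂ) : P.rep ≠ c • Q.rep := by
  intro e
  apply h
  rw [← P.mk_rep, ← Q.mk_rep, Projectivization.mk_eq_mk_iff']
  exact ⟨c, e.symm⟩

theorem mem_pencil {H : MvPolynomial (Fin 6) ℂ} (hF : F.IsHomogeneous 3) (hG : G.IsHomogeneous 3)
    (hH : H.IsHomogeneous 3) (h : H ∈ Ideal.span {F, G}) : ∃ α β : ℂ, H = C α * F + C β * G := by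
  obtain ⟨A, B, hAB⟩ := Ideal.mem_span_pair.1 h
  refine ⟨coeff 0 A, coeff 0 B, ?_⟩
  rw [← homogeneousComponent_zero, ← homogeneousComponent_zero,
    ← homogeneousComponent_mul_isHomogeneous A hF, ← homogeneousComponent_mul_isHomogeneous B hG,
    ← map_add, hAB, hH.component_self]

/-- Cramer's rule; it allows the cone with vertex at the given point to be taken as a generator. -/
theorem span_localize_eq (v : Fin 6 → ℂ) (i : Fin 6) {α β γ δ : ℂ} (h : α * δ - β * γ ≠ 0) :
    Ideal.span {localize v i (C α * F + C β * G), localize v i (C γ * F + C δ * G)} =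
      Ideal.span {localize v i F, localize v i G} := by
  have hC : ∀ a : ℂ, localize v i (C a) = C a := fun a => by simp [localize]
  set f' := localize v i F
  set g' := localize v i G
  have hu : C (α * δ - β * γ)⁻¹ * (C α * C δ - C β * C γ) = (1 : MvPolynomial (Fin 5) ℂ) := by
    rw [← C_mul, ← C_mul, ← C_sub, ← C_mul, inv_mul_cancel₀ h, C_1]
  simp only [map_add, map_mul, hC]
  apply le_antisymm <;>
    rw [Ideal.span_le, Set.insert_subset_iff, Set.singleton_subset_iff] <;>
    refine ⟨Ideal.mem_span_pair.2 ?_, Ideal.mem_span_pair.2 ?_⟩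
  · exact ⟨C α, C β, rfl⟩
  · exact ⟨C γ, C δ, rfl⟩
  · refine ⟨C (α * δ - β * γ)⁻¹ * C δ, - C (α * δ - β * γ)⁻¹ * C β, ?_⟩
    linear_combination f' * hu
  · refine ⟨- C (α * δ - β * γ)⁻¹ * C γ, C (α * δ - β * γ)⁻¹ * C α, ?_⟩
    linear_combination g' * hu

theorem exists_isVertexOfMember (hF : F.IsHomogeneous 3) (hG : G.IsHomogeneous 3)
    (hf : IsPolarForm F f) (hg : IsPolarForm G g) {P : P5} (hP : IsOrdinaryTriplePoint F G P)
    (hI : IsInherited F G P) :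
    ∃ α β : ℂ, (α, β) ≠ 0 ∧ IsVertexOfMember f g α β P.rep := by
  obtain ⟨H, hH, hH0, hmem, htrip⟩ := hI
  obtain ⟨α, β, rfl⟩ := mem_pencil hF hG hH hmem
  have hαβ : (α, β) ≠ 0 := by
    intro h
    simp only [Prod.mk_eq_zero] at h
    simp [h.1, h.2] at hH0
  refine ⟨α, β, hαβ, fun γ δ hd => ?_⟩
  have hh := hf.combination hg α β
  have hk := hf.combination hg γ δ
  have hv := (isTriplePointOfHypersurface_iff hh hH0 P).1 htrip
  obtain ⟨⟨⟨hPF, hPG, -⟩, -⟩, i, hi, hcone⟩ := hP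
  rw [← span_localize_eq _ _ hd] at hcone
  refine (isConeOverSmoothCubicSurface_iff_isOrdinaryVertex hh hk hi hv ?_).1 hcone
  rw [← hk.eval_eq]
  simp [hPF, hPG]

theorem exists_injective_fin {α : Type*} {s : Finset α} {n : ℕ} (h : n ≤ s.card) :
    ∃ p : Fin n → α, Function.Injective p ∧ ∀ i, p i ∈ s := by
  obtain ⟨t, hts, ht⟩ := Finset.exists_subset_card_eq h
  let e := t.equivFinOfCardEq ht
  exact ⟨fun i => (e.symm i).1, fun i j hij => e.symm.injective (Subtype.ext hij),
    fun i => hts (e.symm i).2⟩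

theorem encard_triplePoints_le (h : HasOnlyInheritedTriplePoints F G) :
    (triplePoints F G).encard ≤ 9 := by
  classical
  have hF := h.completeIntersection.homogeneous_left
  have hG := h.completeIntersection.homogeneous_right
  obtain ⟨f, hf, -⟩ := exists_isPolarForm hF
  obtain ⟨g, hg, -⟩ := exists_isPolarForm hG
  have hex : ∀ P : P5, ∃ u : ℂ × ℂ, u ≠ 0 ∧
      (P ∈ triplePoints F G → IsVertexOfMember f g u.1 u.2 P.rep) := by
    intro P
    by_cases hP : P ∈ triplePoints F G
    · obtain ⟨α, β, h0, hv⟩ := exists_isVertexOfMember hF hG hf hg hP (h.inherited P hP)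
      exact ⟨(α, β), h0, fun _ => hv⟩
    -- An arbitrary nonzero value, which makes the map `m` below total.
    · exact ⟨(1, 0), by simp, fun h => absurd h hP⟩
  choose u hu0 hu using hex
  let m : P5 → ℙ ℂ (ℂ × ℂ) := fun P => Projectivization.mk ℂ (u P) (hu0 P)
  have key : ∀ s : Finset P5, (∀ P ∈ s, P ∈ triplePoints F G) → s.card ≤ 9 := by
    intro s hs
    -- Points are sorted by their cone: the fibres of `m` on `s` and its image have at most three
    -- elements each.
    refine (Finset.card_le_mul_card_image (f := m) s 3 ?_).trans
      (Nat.mul_le_mul_left 3 (m := 3) ?_)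
    · intro M _
      by_contra! hcard
      obtain ⟨p, hp, hps⟩ := exists_injective_fin (n := 4) hcard
      simp only [Finset.mem_filter] at hps
      have hT := fun i => hs _ (hps i).1
      obtain ⟨γ, δ, hγδ⟩ : ∃ γ δ : ℂ, (u (p 0)).1 * δ - (u (p 0)).2 * γ ≠ 0 := by
        by_contra! hcon
        apply hu0 (p 0)
        ext
        · simpa using hcon 0 1
        · simpa using hcon 1 0
      have hvert : ∀ i, ((u (p 0)).1 • f + (u (p 0)).2 • g) (p i).rep = 0 := by
        intro i
        have e : m (p 0) = m (p i) := by rw [(hps 0).2, (hps i).2]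
        obtain ⟨a, ha⟩ := (Projectivization.mk_eq_mk_iff' ℂ _ _ _ _).1 e
        obtain ⟨γ', δ', hγδ'⟩ : ∃ γ δ : ℂ, (u (p i)).1 * δ - (u (p i)).2 * γ ≠ 0 := by
          by_contra! hcon
          apply hu0 (p i)
          ext
          · simpa using hcon 0 1
          · simpa using hcon 1 0
        have hv := (hu _ (hT i) γ' δ' hγδ').vertex
        have e1 : (u (p 0)).1 = a * (u (p i)).1 := by rw [← ha]; rfl
        have e2 : (u (p 0)).2 = a * (u (p i)).2 := by rw [← ha]; rfl
        rw [e1, e2, ← smul_smul, ← smul_smul, ← smul_add, LinearMap.smul_apply, hv, smul_zero]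
      have hmem : ∀ i, (γ • f + δ • g) (p i).rep (p i).rep (p i).rep = 0 := by
        intro i
        have h1 := (hT i).1.1.1
        have h2 := (hT i).1.1.2.1
        rw [hf.eval_eq] at h1
        rw [hg.eval_eq] at h2
        simp [h1, h2]
      have hne : ∀ i j, i ≠ j → ∀ c : ℂ, (p i).rep ≠ c • (p j).rep := fun i j hij =>
        rep_ne_smul (hp.ne hij)
      exact (hu _ (hT 0) γ δ hγδ).not_four (hf.symm.combination hg.symm γ δ)
        (hvert 1) (hvert 2) (hvert 3) (hmem 1) (hmem 2) (hmem 3)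
        (hne _ _ (by decide)) (hne _ _ (by decide)) (hne _ _ (by decide))
        (hne _ _ (by decide)) (hne _ _ (by decide)) (hne _ _ (by decide))
    · by_contra! hcard
      obtain ⟨M, hM, hMs⟩ := exists_injective_fin (n := 4) hcard
      simp only [Finset.mem_image] at hMs
      choose p hps hpM using hMs
      refine not_four_members (by simp) hf.symm hg.symm (fun i => (u (p i)).1)
        (fun i => (u (p i)).2) (fun i => (p i).rep) (fun i => hu _ (hs _ (hps i))) ?_
      intro i j hij hd
      apply hM.ne hij
      rw [← hpM, ← hpM]
      refine (Projectivization.mk_eq_mk_iff' ℂ _ _ _ _).2 ?_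
      by_cases h1 : (u (p j)).1 = 0
      · have h2 : (u (p j)).2 ≠ 0 := fun h2 => hu0 (p j) (Prod.ext h1 h2)
        refine ⟨(u (p i)).2 / (u (p j)).2, Prod.ext ?_ ?_⟩
        · have : (u (p i)).1 = 0 := by simpa [h1, h2] using hd
          simp [h1, this]
        · simp [h2]
      · refine ⟨(u (p i)).1 / (u (p j)).1, Prod.ext ?_ ?_⟩
        · simp [h1]
        · simp only [Prod.smul_snd, smul_eq_mul]
          field_simp
          linear_combination hd
  by_contra! hlt
  -- Ten points already contradict `key`, so finiteness need not be known in advance.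
  obtain ⟨t, hts, ht⟩ := Set.exists_subset_encard_eq (s := triplePoints F G) (k := 10)
    (Order.add_one_le_of_lt hlt)
  have htf : t.Finite := Set.finite_of_encard_eq_coe (k := 10) ht
  have h1 := key htf.toFinset (fun P hP => hts (by simpa using hP))
  rw [htf.encard_eq_coe_toFinset_card] at ht
  have : htf.toFinset.card = 10 := by exact_mod_cast ht
  omega

end UpperBound

/-! ### Diagonal cubic forms -/

section Diagonal

/-- The diagonal cubic form with given coefficients. -/
noncomputable def diagonalCubic (c : Fin 6 → ℂ) : MvPolynomial (Fin 6) ℂ := ∑ i, C (c i) * X i ^ 3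

/-- The polar form of a diagonal cubic form. -/
noncomputable def diagonalForm (c : Fin 6 → ℂ) : TrilinearForm (Fin 6 → ℂ) :=
  ∑ i, c i • (LinearMap.proj i : (Fin 6 → ℂ) →ₗ[ℂ] ℂ).smulRight
    ((LinearMap.proj i : (Fin 6 → ℂ) →ₗ[ℂ] ℂ).smulRight (LinearMap.proj i : (Fin 6 → ℂ) →ₗ[ℂ] ℂ))

theorem diagonalForm_apply (c : Fin 6 → ℂ) (u v w : Fin 6 → ℂ) :
    diagonalForm c u v w = ∑ i, c i * (u i * (v i * w i)) := by
  simp [diagonalForm, LinearMap.sum_apply]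

theorem diagonalForm_single (c : Fin 6 → ℂ) (u v : Fin 6 → ℂ) (i : Fin 6) :
    diagonalForm c u v (Pi.single i 1) = c i * (u i * v i) := by
  simp [diagonalForm_apply, Pi.single_apply]

theorem isPolarForm_diagonal (c : Fin 6 → ℂ) : IsPolarForm (diagonalCubic c) (diagonalForm c) where
  symm :=
    { swap_left := fun u v w => by
        simp only [diagonalForm_apply]
        exact Finset.sum_congr rfl fun i _ => by ring
      swap_right := fun u v w => by
        simp only [diagonalForm_apply]
        exact Finset.sum_congr rfl fun i _ => by ring }
  eval_eq y := by
    simp only [diagonalForm_apply, diagonalCubic, map_sum, map_mul, map_pow, eval_C, eval_X]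
    exact Finset.sum_congr rfl fun i _ => by ring

theorem isHomogeneous_diagonalCubic (c : Fin 6 → ℂ) : (diagonalCubic c).IsHomogeneous 3 :=
  IsHomogeneous.sum _ _ _ fun _ _ => isHomogeneous_C_mul_X_pow _ _ _

theorem diagonalCubic_combination (c d : Fin 6 → ℂ) (a b : ℂ) :
    C a * diagonalCubic c + C b * diagonalCubic d = diagonalCubic (a • c + b • d) := by
  simp only [diagonalCubic, Finset.mul_sum, ← Finset.sum_add_distrib]
  refine Finset.sum_congr rfl fun i _ => ?_
  simp
  ring

theorem gradient_diagonalCubic (c : Fin 6 → ℂ) (v : Fin 6 → ℂ) (i : Fin 6) :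
    gradient (diagonalCubic c) v i = 3 * (c i * v i ^ 2) := by
  have := (isPolarForm_diagonal c).gradient_eq (isHomogeneous_diagonalCubic c) v (Pi.single i 1)
  rw [diagonalForm_single] at this
  simp [Pi.single_apply] at this
  rw [this]
  ring

theorem diagonalCubic_ne_zero {c : Fin 6 → ℂ} {i : Fin 6} (hi : c i ≠ 0) :
    diagonalCubic c ≠ 0 := by
  intro h
  have := congrArg (eval (Pi.single i 1)) h
  simp [(isPolarForm_diagonal c).eval_eq, diagonalForm_single, hi] at this

end Diagonal

/-! ### Three pairs of variables and the vertices on their lines -/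

section Blocks

/-- The pairs of variables `(x, y)`, `(z, t)`, `(u, w)`. -/
def block : Fin 6 → Fin 3 := ![0, 0, 1, 1, 2, 2]

/-- The first variable of a pair. -/
def firstOf : Fin 3 → Fin 6 := ![0, 2, 4]

/-- The second variable of a pair. -/
def secondOf : Fin 3 → Fin 6 := ![1, 3, 5]

theorem block_firstOf : ∀ k, block (firstOf k) = k := by decide

theorem block_secondOf : ∀ k, block (secondOf k) = k := by decide

theorem firstOf_ne_secondOf : ∀ k, firstOf k ≠ secondOf k := by decide

theorem block_ne : ∀ k i, i ≠ firstOf k ∧ i ≠ secondOf k → block i ≠ k := by decide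

theorem eq_of_block : ∀ k i, block i = k → i = firstOf k ∨ i = secondOf k := by decide

theorem sum_of_block {k : Fin 3} {φ : Fin 6 → ℂ} (h : ∀ i, block i ≠ k → φ i = 0) :
    ∑ i, φ i = φ (firstOf k) + φ (secondOf k) :=
  Fintype.sum_eq_add _ _ (firstOf_ne_secondOf k) fun i hi => h i (block_ne k i hi)

/-- The zeros of a diagonal cubic form with coefficients `e` on the line of a pair of variables. -/
def IsBlockZero (e : Fin 6 → ℂ) (k : Fin 3) (v : Fin 6 → ℂ) : Prop :=
  (∀ i, block i ≠ k → v i = 0) ∧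
    e (firstOf k) * v (firstOf k) ^ 3 + e (secondOf k) * v (secondOf k) ^ 3 = 0

variable {e : Fin 6 → ℂ} {k : Fin 3} {v : Fin 6 → ℂ}

theorem IsBlockZero.coord_ne_zero (he : ∀ i, e i ≠ 0) (hv : IsBlockZero e k v) (hv0 : v ≠ 0) :
    v (firstOf k) ≠ 0 ∧ v (secondOf k) ≠ 0 := by
  have h1 : v (firstOf k) = 0 ↔ v (secondOf k) = 0 := by
    constructor <;> intro h <;> simpa [h, he] using hv.2
  by_cases h : v (firstOf k) = 0
  · exfalso
    apply hv0
    ext i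
    by_cases hi : block i = k
    · rcases eq_of_block k i hi with rfl | rfl
      exacts [h, h1.1 h]
    · exact hv.1 i hi
  · exact ⟨h, fun h' => h (h1.2 h')⟩

/-- The gradient of the cone at `w` lives on the other two blocks, the tangent hyperplane at `v` on
block `k`. Both are nonzero, so disjoint supports make them independent. -/
theorem isOrdinaryVertex_of_isBlockZero (he : ∀ i, e i ≠ 0) (hv : IsBlockZero e k v) (hv0 : v ≠ 0)
    {r s : Fin 3 → ℂ} (hr : ∀ j, r j = 0 ↔ j = k) (hs : s k ≠ 0) :
    IsOrdinaryVertex (diagonalForm fun i => e i * r (block i))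
      (diagonalForm fun i => e i * s (block i)) v := by
  obtain ⟨ha, hb⟩ := hv.coord_ne_zero he hv0
  have hk : ∀ w, diagonalForm (fun i => e i * s (block i)) v v w =
      s k * (e (firstOf k) * v (firstOf k) ^ 2 * w (firstOf k) +
        e (secondOf k) * v (secondOf k) ^ 2 * w (secondOf k)) := by
    intro w
    rw [diagonalForm_apply, sum_of_block (k := k) fun i hi => by simp [hv.1 i hi]]
    rw [block_firstOf, block_secondOf]
    ring
  have hrk : r k = 0 := (hr k).2 rfl
  refine ⟨hv0, ?_, ?_, ?_, ?_⟩
  · refine LinearMap.ext fun u => LinearMap.ext fun w => ?_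
    rw [diagonalForm_apply]
    refine Finset.sum_eq_zero fun i _ => ?_
    by_cases hi : block i = k
    · simp [hi, hrk]
    · simp [hv.1 i hi]
  · rw [hk]
    linear_combination s k * hv.2
  · intro h
    have := LinearMap.congr_fun h (Pi.single (firstOf k) 1)
    rw [diagonalForm_single, block_firstOf] at this
    simp [he, hs, ha] at this
  · intro w hw hkw _
    rw [hk] at hkw
    have hkw : e (firstOf k) * v (firstOf k) ^ 2 * w (firstOf k) +
        e (secondOf k) * v (secondOf k) ^ 2 * w (secondOf k) = 0 := by simpa [hs] using hkw
    -- In the plane of block `k` both `v` and `w` are killed by the same nonzero functional, so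
    -- there `w` is a multiple of `v`.
    obtain ⟨j, hj, hwj⟩ : ∃ j, block j ≠ k ∧ w j ≠ 0 := by
      by_contra! hcon
      apply hw (w (firstOf k) / v (firstOf k))
      ext i
      by_cases hi : block i = k
      · rcases eq_of_block k i hi with rfl | rfl
        · simp [ha]
        · have h1 : e (secondOf k) * v (secondOf k) ^ 2 *
              (v (secondOf k) * w (firstOf k) - v (firstOf k) * w (secondOf k)) = 0 := by
            linear_combination w (firstOf k) * hv.2 - v (firstOf k) * hkw
          have h2 : v (secondOf k) * w (firstOf k) - v (firstOf k) * w (secondOf k) = 0 := by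
            simpa [he, hb] using h1
          simp only [Pi.smul_apply, smul_eq_mul]
          field_simp
          linear_combination -h2
      · simp [hcon i hi, hv.1 i hi]
    rw [LinearIndependent.pair_iff]
    intro a b hab
    have h1 := LinearMap.congr_fun hab (Pi.single j 1)
    have h2 := LinearMap.congr_fun hab (Pi.single (firstOf k) 1)
    have hrj : r (block j) ≠ 0 := fun h => hj ((hr _).1 h)
    simp only [LinearMap.add_apply, LinearMap.smul_apply, diagonalForm_single, smul_eq_mul,
      LinearMap.zero_apply, block_firstOf, hrk, hv.1 j hj] at h1 h2
    constructor
    · simpa [he, hrj, hwj] using h1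
    · simpa [he, hs, ha] using h2

end Blocks

/-! ### Points of finite sets are isolated -/

section Isolated

/-- For each other point `Q` some 2 × 2 minor against `Q` vanishes at `Q` but not at `P`; the
product of these linear forms separates `P` from the rest. -/
theorem isIsolatedIn_of_finite {S : Set P5} (hS : S.Finite) {P : P5} (hP : P ∈ S) :
    IsIsolatedIn S P := by
  classical
  have hex : ∀ Q : P5, ∃ l : MvPolynomial (Fin 6) ℂ, l.IsHomogeneous 1 ∧
      (Q ≠ P → eval Q.rep l = 0 ∧ eval P.rep l ≠ 0) := by
    intro Q
    by_cases hQ : Q = P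
    · exact ⟨0, isHomogeneous_zero _ _ _, fun h => absurd hQ h⟩
    obtain ⟨i, hi⟩ := Function.ne_iff.1 Q.rep_nonzero
    have hi : Q.rep i ≠ 0 := hi
    obtain ⟨j, hj⟩ : ∃ j, Q.rep i * P.rep j - Q.rep j * P.rep i ≠ 0 := by
      by_contra! hcon
      refine rep_ne_smul (Ne.symm hQ) (P.rep i / Q.rep i) ?_
      ext j
      simp only [Pi.smul_apply, smul_eq_mul]
      field_simp
      linear_combination hcon j
    refine ⟨C (Q.rep i) * X j - C (Q.rep j) * X i,
      (isHomogeneous_C_mul_X _ _).sub (isHomogeneous_C_mul_X _ _), fun _ => ⟨?_, ?_⟩⟩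
    · simp
      ring
    · simpa using hj
  choose l hl hl' using hex
  refine ⟨hP, _, ∏ Q ∈ hS.toFinset.erase P, l Q, IsHomogeneous.prod _ _ _ fun Q _ => hl Q, ?_, ?_⟩
  · rw [map_prod]
    exact Finset.prod_ne_zero_iff.2 fun Q hQ => (hl' Q (Finset.mem_erase.1 hQ).1).2
  · intro Q hQ hne
    rw [map_prod]
    exact Finset.prod_eq_zero (Finset.mem_erase.2 ⟨hne, by simpa using hQ⟩) (hl' Q hne).1

end Isolated

/-! ### Regular sequences of diagonal cubics -/

section RegularSequence

open Polynomial in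
-- Up to a unit the second factor is monic, and a monic polynomial stays a nonzerodivisor modulo
-- `a`.
theorem C_dvd_of_dvd_mul {A : Type*} [CommRing A] {a u b : A} (hu : IsUnit u) {p : A[X]}
    (h : Polynomial.C a ∣ p * (Polynomial.C u * Polynomial.X ^ 3 + Polynomial.C b)) :
    Polynomial.C a ∣ p := by
  obtain ⟨u', hu'⟩ := hu.exists_right_inv
  have h2 : Polynomial.C a ∣ p * (Polynomial.X ^ 3 + Polynomial.C (u' * b)) := by
    have e : p * (Polynomial.X ^ 3 + Polynomial.C (u' * b)) =
        p * (Polynomial.C u * Polynomial.X ^ 3 + Polynomial.C b) * Polynomial.C u' := by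
      have : (Polynomial.C u * Polynomial.C u' : A[X]) = 1 := by
        rw [← Polynomial.C_mul, hu', Polynomial.C_1]
      rw [Polynomial.C_mul]
      linear_combination (-p * Polynomial.X ^ 3) * this
    rw [e]
    exact Dvd.dvd.mul_right h _
  have hmap : p.map (Ideal.Quotient.mk (Ideal.span {a})) = 0 := by
    have hm : (Polynomial.X ^ 3 + Polynomial.C (Ideal.Quotient.mk (Ideal.span {a}) (u' * b))).Monic :=
      Polynomial.monic_X_pow_add_C _ (by norm_num)
    rw [← hm.mul_left_eq_zero_iff]
    obtain ⟨q, hq⟩ := h2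
    have := congrArg (Polynomial.map (Ideal.Quotient.mk (Ideal.span {a}))) hq
    have ha : Ideal.Quotient.mk (Ideal.span {a}) a = 0 :=
      Ideal.Quotient.eq_zero_iff_mem.2 (Ideal.mem_span_singleton_self a)
    rwa [Polynomial.map_mul, Polynomial.map_mul, Polynomial.map_add, Polynomial.map_pow,
      Polynomial.map_X, Polynomial.map_C, Polynomial.map_C, ha, Polynomial.C_0, zero_mul] at this
  rw [Polynomial.C_dvd_iff_dvd_coeff]
  intro i
  have := congrArg (fun q => Polynomial.coeff q i) hmap
  simp only [Polynomial.coeff_map, Polynomial.coeff_zero] at this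
  rwa [Ideal.Quotient.eq_zero_iff_mem, Ideal.mem_span_singleton] at this

/-- Two diagonal forms, one of which does not contain a variable that the other one contains. -/
theorem dvd_of_dvd_mul_diagonalCubic {c d : Fin 6 → ℂ} (hc : c 0 = 0) (hd : d 0 ≠ 0)
    {p : MvPolynomial (Fin 6) ℂ} (h : diagonalCubic c ∣ p * diagonalCubic d) :
    diagonalCubic c ∣ p := by
  -- As polynomials in the variable of index 0, the first form is constant and the second has a unit
  -- as leading coefficient.
  have hfin : ∀ c : Fin 6 → ℂ, finSuccEquiv ℂ 5 (diagonalCubic c) =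
      Polynomial.C (C (c 0)) * Polynomial.X ^ 3 +
        Polynomial.C (∑ i : Fin 5, C (c i.succ) * X i ^ 3) := by
    intro c
    have hC : ∀ a : ℂ, finSuccEquiv ℂ 5 (C a) = Polynomial.C (C a) := fun a => by
      simp [finSuccEquiv_apply]
    rw [diagonalCubic, Fin.sum_univ_succ]
    simp only [map_add, map_mul, map_pow, map_sum, hC, finSuccEquiv_X_zero, finSuccEquiv_X_succ]
  have h1 := map_dvd (finSuccEquiv ℂ 5) h
  rw [map_mul, hfin, hfin, hc, C_0, Polynomial.C_0, zero_mul, zero_add] at h1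
  have h2 := C_dvd_of_dvd_mul ((isUnit_iff_ne_zero.2 hd).map C) h1
  have h3 := map_dvd (finSuccEquiv ℂ 5).symm h2
  rw [AlgEquiv.symm_apply_apply] at h3
  convert h3
  rw [AlgEquiv.eq_symm_apply, hfin, hc, C_0, Polynomial.C_0, zero_mul, zero_add]

theorem isCompleteIntersection33_diagonalCubic {c d : Fin 6 → ℂ} (hc : c 0 = 0) (hc' : c ≠ 0)
    (hd : d 0 ≠ 0) : IsCompleteIntersection33 (diagonalCubic c) (diagonalCubic d) where
  homogeneous_left := isHomogeneous_diagonalCubic c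
  homogeneous_right := isHomogeneous_diagonalCubic d
  regular := by
    obtain ⟨i, hi⟩ := Function.ne_iff.1 hc'
    rw [RingTheory.Sequence.isRegular_iff, RingTheory.Sequence.isWeaklyRegular_cons_iff,
      RingTheory.Sequence.isWeaklyRegular_singleton_iff]
    refine ⟨⟨?_, ?_⟩, ?_⟩
    · exact IsSMulRegular.of_ne_zero (diagonalCubic_ne_zero hi)
    · refine (isSMulRegular_quotient_iff_mem_of_smul_mem _ _).2 fun p hp => ?_
      rw [Submodule.mem_smul_pointwise_iff_exists] at hp ⊢
      obtain ⟨q, -, hq⟩ := hp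
      obtain ⟨r, hr⟩ := dvd_of_dvd_mul_diagonalCubic hc hd (p := p) ⟨q, by
        rw [← smul_eq_mul (a := diagonalCubic c), hq, smul_eq_mul, mul_comm]⟩
      exact ⟨r, trivial, hr.symm⟩
    · intro h
      have h1 : (1 : MvPolynomial (Fin 6) ℂ) ∈
          Ideal.ofList [diagonalCubic c, diagonalCubic d] := by
        have : (1 : MvPolynomial (Fin 6) ℂ) ∈ (⊤ : Ideal (MvPolynomial (Fin 6) ℂ)) := trivial
        rw [h] at this
        simpa using this
      have h2 : Ideal.ofList [diagonalCubic c, diagonalCubic d] ≤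
          RingHom.ker (eval (0 : Fin 6 → ℂ)) := by
        rw [Ideal.ofList, Ideal.span_le]
        intro x hx
        have : x = diagonalCubic c ∨ x = diagonalCubic d := by simpa using hx
        rcases this with rfl | rfl <;> simp [diagonalCubic]
      have := h2 h1
      simp at this

end RegularSequence

/-! ### The nine points and the three lines -/

section BlockPoints

theorem encard_cube_roots {a : ℂ} (ha : a ≠ 0) : {c : ℂ | c ^ 3 = a}.encard = 3 := by
  obtain ⟨b, hb⟩ := IsAlgClosed.exists_pow_nat_eq a (n := 3) (by norm_num)
  have hb0 : b ≠ 0 := by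
    rintro rfl
    exact ha (by simpa using hb.symm)
  have h : {c : ℂ | c ^ 3 = a} = (b * ·) '' (Polynomial.nthRootsFinset 3 (1 : ℂ) : Set ℂ) := by
    ext c
    simp only [Set.mem_ofPred_eq, Set.mem_image, Finset.mem_coe,
      Polynomial.mem_nthRootsFinset (by norm_num : 0 < 3)]
    constructor
    · intro hc
      exact ⟨c / b, by rw [div_pow, hc, hb, div_self ha], mul_div_cancel₀ _ hb0⟩
    · rintro ⟨x, hx, rfl⟩
      rw [mul_pow, hx, hb, mul_one]
  rw [h, (mul_right_injective₀ hb0).encard_image, Set.encard_coe_eq_coe_finsetCard,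
    (Complex.isPrimitiveRoot_exp 3 (by norm_num)).card_nthRootsFinset]
  rfl

variable {e : Fin 6 → ℂ}

/-- The points of the line of a pair of variables at which the diagonal form vanishes. -/
def blockPoints (e : Fin 6 → ℂ) (k : Fin 3) : Set P5 := {P | IsBlockZero e k P.rep}

theorem IsBlockZero.smul {k : Fin 3} {v : Fin 6 → ℂ} (h : IsBlockZero e k v) (a : ℂ) :
    IsBlockZero e k (a • v) := by
  refine ⟨fun i hi => by simp [h.1 i hi], ?_⟩
  simp only [Pi.smul_apply, smul_eq_mul]
  linear_combination a ^ 3 * h.2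

theorem mk_mem_blockPoints {k : Fin 3} {v : Fin 6 → ℂ} (hv : v ≠ 0) :
    Projectivization.mk ℂ v hv ∈ blockPoints e k ↔ IsBlockZero e k v := by
  obtain ⟨a, ha⟩ := Projectivization.exists_smul_eq_mk_rep ℂ v hv
  constructor
  · intro h
    have h1 : IsBlockZero e k (a⁻¹ • a • v) := by
      rw [ha, Units.smul_def]
      exact h.smul _
    rwa [inv_smul_smul] at h1
  · intro h
    change IsBlockZero e k _
    rw [← ha, Units.smul_def]
    exact h.smul _

/-- Neither coordinate of such a point vanishes, so it is `(1 : c)` on its line, with `c` a cube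
root of a fixed nonzero number. -/
theorem encard_blockPoints (he : ∀ i, e i ≠ 0) (k : Fin 3) : (blockPoints e k).encard = 3 := by
  let w : ℂ → (Fin 6 → ℂ) := fun c => Pi.single (firstOf k) 1 + c • Pi.single (secondOf k) 1
  have w1 : ∀ c, w c (firstOf k) = 1 := fun c => by
    simp [w, firstOf_ne_secondOf k]
  have w2 : ∀ c, w c (secondOf k) = c := fun c => by
    simp [w, (firstOf_ne_secondOf k).symm]
  have w3 : ∀ c i, block i ≠ k → w c i = 0 := by
    intro c i hi
    have h1 : i ≠ firstOf k := fun h => hi (h ▸ block_firstOf k)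
    have h2 : i ≠ secondOf k := fun h => hi (h ▸ block_secondOf k)
    simp [w, h1, h2]
  have w0 : ∀ c, w c ≠ 0 := fun c h => by simpa [w1] using congrFun h (firstOf k)
  have hinj : Function.Injective fun c => (Projectivization.mk ℂ (w c) (w0 c) : P5) := by
    intro c d hcd
    obtain ⟨a, ha⟩ := (Projectivization.mk_eq_mk_iff' ℂ _ _ _ _).1 hcd
    have h1 := congrFun ha (firstOf k)
    have h2 := congrFun ha (secondOf k)
    simp only [Pi.smul_apply, smul_eq_mul, w1, w2] at h1 h2
    rw [← h2, show a = 1 by simpa using h1, one_mul]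
  have hzero : ∀ c, IsBlockZero e k (w c) ↔ c ^ 3 = -(e (firstOf k) / e (secondOf k)) := by
    intro c
    have := he (secondOf k)
    rw [IsBlockZero, and_iff_right (w3 c), w1, w2, ← neg_div, eq_div_iff this]
    constructor <;> intro h <;> linear_combination h
  have himage : blockPoints e k = (fun c => (Projectivization.mk ℂ (w c) (w0 c) : P5)) ''
      {c : ℂ | c ^ 3 = -(e (firstOf k) / e (secondOf k))} := by
    ext P
    simp only [Set.mem_image, Set.mem_ofPred_eq]
    constructor
    · intro hP
      have ha := (hP.coord_ne_zero he P.rep_nonzero).1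
      have hmk : Projectivization.mk ℂ (w (P.rep (secondOf k) / P.rep (firstOf k))) (w0 _) = P := by
        conv_rhs => rw [← P.mk_rep]
        rw [Projectivization.mk_eq_mk_iff']
        refine ⟨(P.rep (firstOf k))⁻¹, ?_⟩
        ext i
        by_cases hi : block i = k
        · rcases eq_of_block k i hi with rfl | rfl
          · simp [w1, ha]
          · simp only [w2, Pi.smul_apply, smul_eq_mul]
            ring
        · simp [w3 _ i hi, hP.1 i hi]
      refine ⟨_, (hzero _).1 ?_, hmk⟩
      rw [← mk_mem_blockPoints (w0 _), hmk]
      exact hP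
    · rintro ⟨c, hc, rfl⟩
      exact (mk_mem_blockPoints (w0 c)).2 ((hzero c).2 hc)
  rw [himage, hinj.encard_image]
  exact encard_cube_roots (neg_ne_zero.2 (div_ne_zero (he _) (he _)))

/-- The line of a pair of variables. -/
def blockLine (k : Fin 3) : Submodule ℂ (Fin 6 → ℂ) where
  carrier := {v | ∀ i, block i ≠ k → v i = 0}
  zero_mem' := by simp
  add_mem' hu hv i hi := by simp [hu i hi, hv i hi]
  smul_mem' a v hv i hi := by simp [hv i hi]

theorem disjoint_blockLine {j k : Fin 3} (h : j ≠ k) : Disjoint (blockLine j) (blockLine k) := by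
  rw [Submodule.disjoint_def]
  intro v hj hk
  ext i
  by_cases hi : block i = j
  · exact hk i (hi ▸ h)
  · exact hj i hi

theorem finrank_blockLine (k : Fin 3) : Module.finrank ℂ (blockLine k) = 2 := by
  let φ : blockLine k ≃ₗ[ℂ] (Fin 2 → ℂ) :=
    { toFun := fun v => ![v.1 (firstOf k), v.1 (secondOf k)]
      map_add' := fun u v => by ext i; fin_cases i <;> simp
      map_smul' := fun a v => by ext i; fin_cases i <;> simp
      invFun := fun y => ⟨fun i => if i = firstOf k then y 0 else if i = secondOf k then y 1 else 0,
        fun i hi => by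
          have h1 : i ≠ firstOf k := fun h => hi (h ▸ block_firstOf k)
          have h2 : i ≠ secondOf k := fun h => hi (h ▸ block_secondOf k)
          simp [h1, h2]⟩
      left_inv := fun v => by
        ext i
        by_cases hi : block i = k
        · rcases eq_of_block k i hi with rfl | rfl
          · simp
          · simp [(firstOf_ne_secondOf k).symm]
        · have h1 : i ≠ firstOf k := fun h => hi (h ▸ block_firstOf k)
          have h2 : i ≠ secondOf k := fun h => hi (h ▸ block_secondOf k)
          simp [h1, h2, v.2 i hi]
      right_inv := fun y => by
        ext i
        fin_cases i <;> simp [(firstOf_ne_secondOf k).symm] }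
  rw [φ.finrank_eq]
  simp

theorem submodule_le_blockLine {k : Fin 3} {P : P5} :
    P.submodule ≤ blockLine k ↔ P.rep ∈ blockLine k := by
  rw [Projectivization.submodule_eq, Submodule.span_singleton_le_iff_mem]

theorem blockPoints_unique {j k : Fin 3} {P : P5} (hj : P ∈ blockPoints e j)
    (hk : P.rep ∈ blockLine k) : j = k := by
  by_contra h
  exact P.rep_nonzero (Submodule.disjoint_def.1 (disjoint_blockLine h) _ hj.1 hk)

theorem disjoint_blockPoints {j k : Fin 3} (h : j ≠ k) :
    Disjoint (blockPoints e j) (blockPoints e k) :=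
  Set.disjoint_left.2 fun _ hj hk => h (blockPoints_unique hj hk.1)

theorem encard_iUnion_blockPoints (he : ∀ i, e i ≠ 0) : (⋃ k, blockPoints e k).encard = 9 := by
  have h : ⋃ k, blockPoints e k = (blockPoints e 0 ∪ blockPoints e 1) ∪ blockPoints e 2 := by
    ext P
    simp [Fin.exists_fin_succ, or_assoc]
  rw [h, Set.encard_union_eq, Set.encard_union_eq (disjoint_blockPoints (by decide)),
    encard_blockPoints he, encard_blockPoints he, encard_blockPoints he]
  · norm_num
  · exact Set.disjoint_union_left.2
      ⟨disjoint_blockPoints (by decide), disjoint_blockPoints (by decide)⟩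

theorem isThreeCollinearTriples_blockPoints (he : ∀ i, e i ≠ 0) :
    IsThreeCollinearTriples (⋃ k, blockPoints e k) := by
  refine ⟨blockLine, finrank_blockLine, fun j k => disjoint_blockLine, ?_, ?_⟩
  · intro P hP
    obtain ⟨k, hk⟩ := Set.mem_iUnion.1 hP
    exact ⟨k, submodule_le_blockLine.2 hk.1⟩
  · intro k
    rw [← encard_blockPoints he k]
    congr 1
    ext P
    rw [Set.mem_ofPred_eq, submodule_le_blockLine, Set.mem_iUnion]
    constructor
    · rintro ⟨⟨j, hj⟩, hk⟩
      rwa [← blockPoints_unique hj hk]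
    · exact fun h => ⟨⟨k, h⟩, h.1⟩

end BlockPoints

/-! ### The example as a pencil of block forms -/

section BlockPencil

variable (e : Fin 6 → ℂ)

/-- A member of the net spanned by the diagonal forms in the three pairs of variables. -/
noncomputable def blockCubic (r : Fin 3 → ℂ) : MvPolynomial (Fin 6) ℂ :=
  diagonalCubic fun i => e i * r (block i)

theorem blockCubic_combination (r s : Fin 3 → ℂ) (a b : ℂ) :
    C a * blockCubic e r + C b * blockCubic e s = blockCubic e (a • r + b • s) := by
  rw [blockCubic, blockCubic, blockCubic, diagonalCubic_combination]
  congr 1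
  ext i
  simp
  ring

variable {e}

theorem eval_blockCubic {k : Fin 3} {v : Fin 6 → ℂ} (hv : ∀ i, block i ≠ k → v i = 0)
    (r : Fin 3 → ℂ) : eval v (blockCubic e r) =
      r k * (e (firstOf k) * v (firstOf k) ^ 3 + e (secondOf k) * v (secondOf k) ^ 3) := by
  rw [blockCubic, (isPolarForm_diagonal _).eval_eq, diagonalForm_apply,
    sum_of_block (k := k) fun i hi => by simp [hv i hi], block_firstOf, block_secondOf]
  ring

/-- The weights of the first generator of the pencil. -/
def leftWeight : Fin 3 → ℂ := ![0, 1, -1]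

/-- The weights of the second generator of the pencil. -/
def rightWeight : Fin 3 → ℂ := ![1, -1, 0]

/-- The members missing blocks 0, 1, 2 are the first generator, the sum of the two, and the second
generator. -/
theorem exists_vertex_weight (k : Fin 3) : ∃ α β γ δ : ℂ, α * δ - β * γ ≠ 0 ∧
    (∀ j, (α • leftWeight + β • rightWeight) j = 0 ↔ j = k) ∧
    (γ • leftWeight + δ • rightWeight) k ≠ 0 := by
  fin_cases k
  · refine ⟨1, 0, 0, 1, ?_, fun j => ?_, ?_⟩
    · simp
    · fin_cases j <;> simp [leftWeight, rightWeight]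
    · simp [leftWeight, rightWeight]
  · refine ⟨1, 1, 0, 1, ?_, fun j => ?_, ?_⟩
    · simp
    · fin_cases j <;> simp [leftWeight, rightWeight]
    · simp [leftWeight, rightWeight]
  · refine ⟨0, 1, 1, 0, ?_, fun j => ?_, ?_⟩
    · simp
    · fin_cases j <;> simp [leftWeight, rightWeight]
    · simp [leftWeight, rightWeight]

/-- A relation `(s, t)` between the gradients kills every coordinate in a block of nonzero weight.
The weights `t`, `s - t`, `-s` vanish in at most one block, so the point lies on one of the three
lines. -/
theorem singularLocus_blockCubic (he : ∀ i, e i ≠ 0) :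
    singularLocus (blockCubic e leftWeight) (blockCubic e rightWeight) =
      ⋃ k, blockPoints e k := by
  ext P
  rw [Set.mem_iUnion]
  constructor
  · rintro ⟨hF, hG, hdep⟩
    rw [LinearIndependent.pair_iff] at hdep
    push Not at hdep
    obtain ⟨s, t, hst, hne⟩ := hdep
    have hw : ∀ i, P.rep i ≠ 0 → s * leftWeight (block i) + t * rightWeight (block i) = 0 := by
      intro i hi
      have := congrFun hst i
      simp only [blockCubic, Pi.add_apply, Pi.smul_apply, smul_eq_mul, gradient_diagonalCubic,
        Pi.zero_apply] at this
      have h1 : 3 * (e i * P.rep i ^ 2) *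
          (s * leftWeight (block i) + t * rightWeight (block i)) = 0 := by
        linear_combination this
      simpa [he, hi] using h1
    obtain ⟨i, hi⟩ := Function.ne_iff.1 P.rep_nonzero
    have huniq : ∀ j k : Fin 3, s * leftWeight j + t * rightWeight j = 0 →
        s * leftWeight k + t * rightWeight k = 0 → j = k := by
      intro j k hj hk
      by_contra hjk
      have hs0 : s = 0 ∧ t = 0 := by
        fin_cases j <;> fin_cases k <;> simp [leftWeight, rightWeight] at hj hk hjk <;>
          constructor <;> first | assumption | linear_combination hj | linear_combination hk |
            linear_combination hj + hk |
            linear_combination hk - hj | linear_combination hj - hk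
      exact hne hs0.1 hs0.2
    have hsupp : ∀ j, block j ≠ block i → P.rep j = 0 := by
      intro j hj
      by_contra hPj
      exact hj (huniq _ _ (hw j hPj) (hw i hi))
    refine ⟨block i, hsupp, ?_⟩
    rw [eval_blockCubic hsupp] at hF hG
    by_contra h0
    have h1 : leftWeight (block i) = 0 := by simpa [h0] using hF
    have h2 : rightWeight (block i) = 0 := by simpa [h0] using hG
    generalize block i = k at h1 h2
    fin_cases k <;> simp [leftWeight, rightWeight] at h1 h2
  · rintro ⟨k, hk⟩
    refine ⟨by rw [eval_blockCubic hk.1, hk.2, mul_zero],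
      by rw [eval_blockCubic hk.1, hk.2, mul_zero], fun hli => ?_⟩
    obtain ⟨α, β, γ, δ, hd, hr, -⟩ := exists_vertex_weight k
    rw [LinearIndependent.pair_iff] at hli
    have := hli α β (by
      ext i
      simp only [blockCubic, Pi.add_apply, Pi.smul_apply, smul_eq_mul, gradient_diagonalCubic,
        Pi.zero_apply]
      by_cases hi : block i = k
      · have h1 := (hr k).2 rfl
        simp only [Pi.add_apply, Pi.smul_apply, smul_eq_mul] at h1
        rw [hi]
        linear_combination 3 * e i * P.rep i ^ 2 * h1
      · simp [hk.1 i hi])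
    simp [this.1, this.2] at hd

theorem isOrdinaryTriplePoint_blockCubic (he : ∀ i, e i ≠ 0) {k : Fin 3} {P : P5}
    (hP : P ∈ blockPoints e k) :
    IsOrdinaryTriplePoint (blockCubic e leftWeight) (blockCubic e rightWeight) P ∧
      IsInherited (blockCubic e leftWeight) (blockCubic e rightWeight) P := by
  obtain ⟨α, β, γ, δ, hd, hr, hs⟩ := exists_vertex_weight k
  have hvert := isOrdinaryVertex_of_isBlockZero he hP P.rep_nonzero hr hs
  have hh := isPolarForm_diagonal fun i => e i * (α • leftWeight + β • rightWeight) (block i)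
  have hk := isPolarForm_diagonal fun i => e i * (γ • leftWeight + δ • rightWeight) (block i)
  refine ⟨⟨?_, ?_⟩, ?_⟩
  · rw [singularLocus_blockCubic he]
    refine isIsolatedIn_of_finite ?_ (Set.mem_iUnion.2 ⟨k, hP⟩)
    exact Set.finite_of_encard_eq_coe (k := 9) (encard_iUnion_blockPoints he)
  · obtain ⟨i, hi⟩ := Function.ne_iff.1 P.rep_nonzero
    refine ⟨i, hi, ?_⟩
    rw [← span_localize_eq _ _ hd, blockCubic_combination, blockCubic_combination]
    exact (isConeOverSmoothCubicSurface_iff_isOrdinaryVertex hh hk hi hvert.vertex hvert.mem).2 hvert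
  · obtain ⟨j, hj⟩ : ∃ j : Fin 3, j ≠ k := exists_ne k
    have hne : blockCubic e (α • leftWeight + β • rightWeight) ≠ 0 := by
      refine diagonalCubic_ne_zero (i := firstOf j) (mul_ne_zero (he _) ?_)
      rw [block_firstOf]
      exact fun h => hj ((hr j).1 h)
    refine ⟨_, isHomogeneous_diagonalCubic _, hne, ?_,
      (isTriplePointOfHypersurface_iff hh hne P).2 hvert.vertex⟩
    change blockCubic e (α • leftWeight + β • rightWeight) ∈ _
    rw [← blockCubic_combination]
    exact Ideal.mem_span_pair.2 ⟨C α, C β, rfl⟩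

theorem triplePoints_blockCubic (he : ∀ i, e i ≠ 0) :
    triplePoints (blockCubic e leftWeight) (blockCubic e rightWeight) = ⋃ k, blockPoints e k := by
  ext P
  constructor
  · intro hP
    rw [← singularLocus_blockCubic he]
    exact hP.1.1
  · intro hP
    obtain ⟨k, hk⟩ := Set.mem_iUnion.1 hP
    exact (isOrdinaryTriplePoint_blockCubic he hk).1

theorem hasOnlyInheritedTriplePoints_blockCubic (he : ∀ i, e i ≠ 0) :
    HasOnlyInheritedTriplePoints (blockCubic e leftWeight) (blockCubic e rightWeight) where
  completeIntersection := by
    refine isCompleteIntersection33_diagonalCubic ?_ ?_ ?_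
    · simp [block, leftWeight]
    · exact fun h => he 2 (by simpa [block, leftWeight] using congrFun h 2)
    · simp [block, rightWeight, he]
  ordinary P hP := by
    rw [singularLocus_blockCubic he] at hP
    obtain ⟨k, hk⟩ := Set.mem_iUnion.1 hP
    exact (isOrdinaryTriplePoint_blockCubic he hk).1
  inherited P hP := by
    have := hP.1.1
    rw [singularLocus_blockCubic he] at this
    obtain ⟨k, hk⟩ := Set.mem_iUnion.1 this
    exact (isOrdinaryTriplePoint_blockCubic he hk).2

/-- The relations `b₃ = -a₁`, `b₄ = -a₂` make the `z, t` parts of the two cubics proportional, which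
produces the third cone. -/
theorem example_eq_blockCubic (a₁ a₂ a₃ a₄ b₁ b₂ : ℂ) :
    exampleF a₁ a₂ a₃ a₄ = blockCubic ![b₁, b₂, a₁, a₂, -a₃, -a₄] leftWeight ∧
      exampleG b₁ b₂ (-a₁) (-a₂) = blockCubic ![b₁, b₂, a₁, a₂, -a₃, -a₄] rightWeight := by
  constructor <;>
    simp [exampleF, exampleG, blockCubic, diagonalCubic, Fin.sum_univ_six, block, leftWeight,
      rightWeight]

end BlockPencil

end TriplePoints

theorem theorem2 :
    (∀ F G : MvPolynomial (Fin 6) ℂ, TriplePoints.HasOnlyInheritedTriplePoints F G →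
      (TriplePoints.triplePoints F G).encard ≤ 9) ∧
    (∀ a₁ a₂ a₃ a₄ b₁ b₂ b₃ b₄ : ℂ, a₁ ≠ 0 → a₂ ≠ 0 → a₃ ≠ 0 → a₄ ≠ 0 → b₁ ≠ 0 → b₂ ≠ 0 →
      a₁ = -b₃ → a₂ = -b₄ →
      TriplePoints.HasOnlyInheritedTriplePoints
        (TriplePoints.exampleF a₁ a₂ a₃ a₄) (TriplePoints.exampleG b₁ b₂ b₃ b₄) ∧
      (TriplePoints.triplePoints
        (TriplePoints.exampleF a₁ a₂ a₃ a₄) (TriplePoints.exampleG b₁ b₂ b₃ b₄)).encard = 9 ∧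
      TriplePoints.IsThreeCollinearTriples
        (TriplePoints.triplePoints
          (TriplePoints.exampleF a₁ a₂ a₃ a₄) (TriplePoints.exampleG b₁ b₂ b₃ b₄))) := by
  refine ⟨fun F G h => TriplePoints.encard_triplePoints_le h, ?_⟩
  intro a₁ a₂ a₃ a₄ b₁ b₂ b₃ b₄ h1 h2 h3 h4 h5 h6 h7 h8
  obtain ⟨hF, hG⟩ := TriplePoints.example_eq_blockCubic a₁ a₂ a₃ a₄ b₁ b₂
  obtain rfl : b₃ = -a₁ := by rw [h7, neg_neg]
  obtain rfl : b₄ = -a₂ := by rw [h8, neg_neg]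
  have he : ∀ i, (![b₁, b₂, a₁, a₂, -a₃, -a₄] : Fin 6 → ℂ) i ≠ 0 := by
    intro i
    fin_cases i <;> simpa
  rw [hF, hG, TriplePoints.triplePoints_blockCubic he]
  exact ⟨TriplePoints.hasOnlyInheritedTriplePoints_blockCubic he,
    TriplePoints.encard_iUnion_blockPoints he, TriplePoints.isThreeCollinearTriples_blockPoints he⟩
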